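/- Let $J=\begin{pmatrix}0&1\\-1&0\end{pmatrix}$, let $e_1,\dots,e_4$ be the standard basis of $\mathbb R^4$, and for $B\in O(4)$, $b\in\mathbb R^4$ let $BL_b$ denote the isometry $x\mapsto B(x+b)$ of $\mathbb R^4$. Put $$B_1=\mathrm{diag}(1,1,-1,-1),\quad B_2=\mathrm{diag}(1,-1,-1,1),\quad B'=\mathrm{diag}(J,-1,1),$$ and let $\Gamma$ be the group of isometries generated by $B_1L_{e_1/2}$, $B_2L_{e_4/2}$ and the translations by $\mathbb Z^4$, and $\Gamma'$ the group generated by $B'L_{e_4/4}$ and the translations by $\mathbb Z^4$. Then $\Gamma$ and $\Gamma'$ are Bieberbach groups (discrete, cocompact, torsion-free groups of isometries), so that $M_\Gamma=\Gamma\backslash\mathbb R^4$ and $M_{\Gamma'}=\Gamma'\backslash\mathbb R^4$, with the metrics induced from $\mathbb R^4$, are compact flat Riemannian manifolds of dimension $4$. The holonomy group (equivalently, the point group $F=\{B: BL_b\in\Gamma\}$) of $M_\Gamma$ is isomorphic to $\mathbb Z_2\times\mathbb Z_2$ and that of $M_{\Gamma'}$ is isomorphic to $\mathbb Z_4$. For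 every odd $p$ (that is, $p=1,3$, larger $p$ being trivial) the trace $\mathrm{tr}_p(B)$ of the map induced on $\Lambda^p(\mathbb R^4)$ by any nontrivial element $B$ of either of the holonomy groups is $0$. The manifolds $M_\Gamma$ and $M_{\Gamma'}$ are isospectral on $p$-forms for every odd $p$: their Hodge--Laplace operators on smooth $p$-forms have the same eigenvalues with the same multiplicities. -/

import Mathlib

open Set Filter Topology
open scoped Manifold ContDiff

noncomputable section

namespace FlatGeom

/-- Euclidean space `ℝⁿ`. -/
abbrev E (n : ℕ) : Type := EuclideanSpace ℝ (Fin n)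

/-! ### The Hodge-Laplace operator on complex-valued forms on `ℝⁿ` -/

/-- The codifferential of the Euclidean metric, `δη = -∑ᵢ ι_{eᵢ} ∇_{eᵢ} η`. -/
def codiff {n p : ℕ} (η : E n → E n [⋀^Fin (p + 1)]→L[ℝ] ℂ) :
    E n → E n [⋀^Fin p]→L[ℝ] ℂ :=
  fun x => -∑ i : Fin n,
    (fderiv ℝ η x (EuclideanSpace.single i 1)).curryLeft (EuclideanSpace.single i 1)

/-- The Hodge-Laplace operator `dδ + δd` on `p`-forms (and `δd` on functions). -/
def hodgeLaplacian {n : ℕ} : {p : ℕ} → (E n → E n [⋀^Fin p]→L[ℝ] ℂ) →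
    E n → E n [⋀^Fin p]→L[ℝ] ℂ
  | 0, η => codiff (extDeriv η)
  | _ + 1, η => fun x => extDeriv (codiff η) x + codiff (extDeriv η) x

section Euclid

variable {n p : ℕ}

theorem codiff_add {α β : E n → E n [⋀^Fin (p + 1)]→L[ℝ] ℂ} {x : E n}
    (hα : DifferentiableAt ℝ α x) (hβ : DifferentiableAt ℝ β x) :
    codiff (α + β) x = codiff α x + codiff β x := by
  simp only [codiff, fderiv_add hα hβ, add_apply,
    ContinuousAlternatingMap.curryLeft_add, Finset.sum_add_distrib, neg_add]

theorem codiff_smul (c : ℂ) {α : E n → E n [⋀^Fin (p + 1)]→L[ℝ] ℂ} {x : E n}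
    (hα : DifferentiableAt ℝ α x) : codiff (c • α) x = c • codiff α x := by
  simp only [codiff, fderiv_const_smul hα, smul_neg, Finset.smul_sum]
  rfl

theorem extDeriv_smul_complex (c : ℂ) {α : E n → E n [⋀^Fin p]→L[ℝ] ℂ} {x : E n}
    (hα : DifferentiableAt ℝ α x) : extDeriv (c • α) x = c • extDeriv α x := by
  ext v
  simp only [extDeriv, fderiv_const_smul hα, ContinuousAlternatingMap.smul_apply,
    ContinuousAlternatingMap.alternatizeUncurryFin_apply, Finset.smul_sum]
  refine Finset.sum_congr rfl fun i _ => ?_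
  rw [smul_comm]
  rfl

theorem contDiffOn_codiff {α : E n → E n [⋀^Fin (p + 1)]→L[ℝ] ℂ} {s : Set (E n)}
    (hs : IsOpen s) (hα : ContDiffOn ℝ ∞ α s) : ContDiffOn ℝ ∞ (codiff α) s := by
  have h : ContDiffOn ℝ ∞ (fderiv ℝ α) s := hα.fderiv_of_isOpen hs (by simp)
  refine ContDiffOn.neg (ContDiffOn.sum fun i _ => ?_)
  have h1 : ContDiffOn ℝ ∞ (fun x => fderiv ℝ α x (EuclideanSpace.single i 1)) s :=
    h.clm_apply contDiffOn_const
  have h2 := (ContinuousLinearMap.contDiff (n := ∞) (E := E n [⋀^Fin (p + 1)]→L[ℝ] ℂ)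
    (F := E n →L[ℝ] E n [⋀^Fin p]→L[ℝ] ℂ)
    ContinuousAlternatingMap.curryLeftLI.toContinuousLinearMap).comp_contDiffOn h1
  exact h2.clm_apply contDiffOn_const

theorem contDiffOn_extDeriv {α : E n → E n [⋀^Fin p]→L[ℝ] ℂ} {s : Set (E n)}
    (hs : IsOpen s) (hα : ContDiffOn ℝ ∞ α s) : ContDiffOn ℝ ∞ (extDeriv α) s := by
  have h : ContDiffOn ℝ ∞ (fderiv ℝ α) s := hα.fderiv_of_isOpen hs (by simp)
  exact (ContinuousAlternatingMap.alternatizeUncurryFinCLM ℝ (E n) ℂ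
    (n := p)).contDiff.comp_contDiffOn h

theorem differentiableAt_of_contDiffOn {F : Type*} [NormedAddCommGroup F] [NormedSpace ℝ F]
    {f : E n → F} {s : Set (E n)} (hs : IsOpen s) (hf : ContDiffOn ℝ ∞ f s) {x : E n}
    (hx : x ∈ s) : DifferentiableAt ℝ f x :=
  (hf.contDiffAt (hs.mem_nhds hx)).differentiableAt (by simp)

theorem codiff_congr {α β : E n → E n [⋀^Fin (p + 1)]→L[ℝ] ℂ} {x : E n}
    (h : α =ᶠ[𝓝 x] β) : codiff α x = codiff β x := by
  simp only [codiff, h.fderiv_eq]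

theorem hodgeLaplacian_add {α β : E n → E n [⋀^Fin p]→L[ℝ] ℂ} {s : Set (E n)}
    (hs : IsOpen s) (hα : ContDiffOn ℝ ∞ α s) (hβ : ContDiffOn ℝ ∞ β s) {x : E n}
    (hx : x ∈ s) : hodgeLaplacian (α + β) x = hodgeLaplacian α x + hodgeLaplacian β x := by
  have hd : codiff (extDeriv (α + β)) x = codiff (extDeriv α) x + codiff (extDeriv β) x := by
    rw [← codiff_add (differentiableAt_of_contDiffOn hs (contDiffOn_extDeriv hs hα) hx)
      (differentiableAt_of_contDiffOn hs (contDiffOn_extDeriv hs hβ) hx)]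
    refine codiff_congr (Filter.eventually_of_mem (hs.mem_nhds hx) fun y hy => ?_)
    exact extDeriv_add (differentiableAt_of_contDiffOn hs hα hy)
      (differentiableAt_of_contDiffOn hs hβ hy)
  cases p with
  | zero => exact hd
  | succ p =>
    have hd' : extDeriv (codiff (α + β)) x = extDeriv (codiff α) x + extDeriv (codiff β) x := by
      rw [← extDeriv_add (differentiableAt_of_contDiffOn hs (contDiffOn_codiff hs hα) hx)
        (differentiableAt_of_contDiffOn hs (contDiffOn_codiff hs hβ) hx)]
      refine Filter.EventuallyEq.extDeriv_eq
        (Filter.eventually_of_mem (hs.mem_nhds hx) fun y hy => ?_)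
      exact codiff_add (differentiableAt_of_contDiffOn hs hα hy)
        (differentiableAt_of_contDiffOn hs hβ hy)
    simp only [hodgeLaplacian, hd, hd']
    abel

theorem hodgeLaplacian_smul (c : ℂ) {α : E n → E n [⋀^Fin p]→L[ℝ] ℂ} {s : Set (E n)}
    (hs : IsOpen s) (hα : ContDiffOn ℝ ∞ α s) {x : E n} (hx : x ∈ s) :
    hodgeLaplacian (c • α) x = c • hodgeLaplacian α x := by
  have hd : codiff (extDeriv (c • α)) x = c • codiff (extDeriv α) x := by
    rw [← codiff_smul c (differentiableAt_of_contDiffOn hs (contDiffOn_extDeriv hs hα) hx)]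
    refine codiff_congr (Filter.eventually_of_mem (hs.mem_nhds hx) fun y hy => ?_)
    exact extDeriv_smul_complex c (differentiableAt_of_contDiffOn hs hα hy)
  cases p with
  | zero => exact hd
  | succ p =>
    have hd' : extDeriv (codiff (c • α)) x = c • extDeriv (codiff α) x := by
      rw [← extDeriv_smul_complex c
        (differentiableAt_of_contDiffOn hs (contDiffOn_codiff hs hα) hx)]
      refine Filter.EventuallyEq.extDeriv_eq
        (Filter.eventually_of_mem (hs.mem_nhds hx) fun y hy => ?_)
      exact codiff_smul c (differentiableAt_of_contDiffOn hs hα hy)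
    simp only [hodgeLaplacian, hd, hd', smul_add]

end Euclid

/-! ### Flat manifolds, forms, spectrum -/

section Manifold

variable (n : ℕ) (M : Type) [TopologicalSpace M] [ChartedSpace (E n) M]

/-- `M` is a closed connected flat Riemannian manifold of dimension `n`, its Riemannian metric
being the one for which the charts of the atlas are isometries onto open sets of `ℝⁿ`: all
transition maps coincide locally with isometries of `ℝⁿ`. -/
structure IsClosedFlatManifold : Prop where
  t2 : T2Space M
  secondCountable : SecondCountableTopology M
  compact : CompactSpace M
  connected : ConnectedSpace M
  transition : ∀ e ∈ atlas (E n) M, ∀ e' ∈ atlas (E n) M, ∀ y ∈ (e.symm.trans e').source,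
    ∃ g : E n ≃ᵃⁱ[ℝ] E n, (e' ∘ e.symm) =ᶠ[𝓝 y] g

/-- A (not necessarily smooth) complex-valued `p`-form on `M`. -/
abbrev RoughForm (p : ℕ) : Type :=
  (x : M) → TangentSpace 𝓘(ℝ, E n) x [⋀^Fin p]→L[ℝ] ℂ

variable {n M}

/-- The expression `(e⁻¹)^* η` of a form in a chart `e`. -/
def chartRep {p : ℕ} (e : OpenPartialHomeomorph M (E n)) (η : RoughForm n M p) :
    E n → E n [⋀^Fin p]→L[ℝ] ℂ :=
  fun y => (η (e.symm y)).compContinuousLinearMap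
    (mfderiv 𝓘(ℝ, E n) 𝓘(ℝ, E n) e.symm y : E n →L[ℝ] TangentSpace 𝓘(ℝ, E n) (e.symm y))

variable (n M)

/-- The space of smooth `p`-forms `η` on `M` with `(dδ + δd) η = l η`. The charts are isometries,
so that in each of them the Hodge-Laplace operator of `M` is the one of `ℝⁿ`. -/
def eigenforms (p : ℕ) (l : ℂ) : Submodule ℂ (RoughForm n M p) where
  carrier := {η | ∀ e ∈ atlas (E n) M, ContDiffOn ℝ ∞ (chartRep e η) e.target ∧
    ∀ y ∈ e.target, hodgeLaplacian (chartRep e η) y = l • chartRep e η y}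
  zero_mem' := by
    intro e he
    have h0 : chartRep e (0 : RoughForm n M p) = 0 := rfl
    have hs : ContDiffOn ℝ ∞ (0 : E n → E n [⋀^Fin p]→L[ℝ] ℂ) e.target := contDiffOn_const
    refine ⟨h0 ▸ hs, fun y hy => ?_⟩
    have h2 := hodgeLaplacian_smul 0 e.open_target hs hy
    have h3 : ((0 : ℂ) • (0 : E n → E n [⋀^Fin p]→L[ℝ] ℂ)) = 0 := by
      ext y v
      simp
    have h4 : (0 : ℂ) • hodgeLaplacian (0 : E n → E n [⋀^Fin p]→L[ℝ] ℂ) y = 0 := by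
      ext v
      simp
    rw [h3, h4] at h2
    rw [h0, h2]
    ext v
    simp
  add_mem' := by
    intro a b ha hb e he
    have h0 : chartRep e (a + b) = chartRep e a + chartRep e b := rfl
    refine ⟨h0 ▸ (ha e he).1.add (hb e he).1, fun y hy => ?_⟩
    rw [h0, hodgeLaplacian_add e.open_target (ha e he).1 (hb e he).1 hy, (ha e he).2 y hy,
      (hb e he).2 y hy, Pi.add_apply, smul_add]
  smul_mem' := by
    intro c a ha e he
    have h0 : chartRep e (c • a) = c • chartRep e a := rfl
    refine ⟨h0 ▸ (ha e he).1.const_smul c, fun y hy => ?_⟩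
    rw [h0, hodgeLaplacian_smul c e.open_target (ha e he).1 hy, (ha e he).2 y hy, Pi.smul_apply,
      smul_comm]

/-- Two closed flat manifolds are `p`-isospectral: every number is an eigenvalue of their
Hodge-Laplace operators on smooth `p`-forms with the same multiplicity. -/
def PIsospectral (p n : ℕ) (M M' : Type) [TopologicalSpace M] [ChartedSpace (E n) M]
    [TopologicalSpace M'] [ChartedSpace (E n) M'] : Prop :=
  ∀ l : ℂ, Module.rank ℂ (eigenforms n M p l) = Module.rank ℂ (eigenforms n M' p l)

/-! ### Parallel transport and holonomy -/

variable {n M}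

/-- The coordinates in the chart `e` of a tangent vector of `M`. -/
def chartVec (e : OpenPartialHomeomorph M (E n)) (x : M) (v : TangentSpace 𝓘(ℝ, E n) x) : E n :=
  mfderiv 𝓘(ℝ, E n) 𝓘(ℝ, E n) e x v

/-- A vector field along a path is parallel: its coordinates in every isometric chart are
locally constant. -/
def IsParallelAlong {x y : M} (c : Path x y)
    (X : (t : unitInterval) → TangentSpace 𝓘(ℝ, E n) (c t)) : Prop :=
  ∀ e ∈ atlas (E n) M, ∀ t, c t ∈ e.source →
    ∀ᶠ s in 𝓝 t, chartVec e (c s) (X s) = chartVec e (c t) (X t)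

/-- `A` is the parallel transport along the loop `c`. -/
def IsParallelTransport {x : M} (c : Path x x)
    (A : TangentSpace 𝓘(ℝ, E n) x ≃ₗ[ℝ] TangentSpace 𝓘(ℝ, E n) x) : Prop :=
  ∀ v, ∃ X : (t : unitInterval) → TangentSpace 𝓘(ℝ, E n) (c t),
    IsParallelAlong c X ∧ HEq (X 0) v ∧ HEq (X 1) (A v)

variable (n)

/-- The holonomy group of a flat manifold at `x`: the parallel transports along the loops at `x`
(they form a group already). -/
def holonomyGroup (x : M) :
    Subgroup (TangentSpace 𝓘(ℝ, E n) x ≃ₗ[ℝ] TangentSpace 𝓘(ℝ, E n) x) :=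
  Subgroup.closure {A | ∃ c : Path x x, IsParallelTransport c A}

end Manifold

/-- `tr_p f`, the trace of the map induced by `f` on the `p`-th exterior power. -/
def extTrace {V : Type} [AddCommGroup V] [Module ℝ V] (p : ℕ) (f : V →ₗ[ℝ] V) : ℝ :=
  LinearMap.trace ℝ (⋀[ℝ]^p V) (exteriorPower.map p f)

/-! ### Bieberbach groups and their quotients -/

/-- The tautological action of the isometry group on `ℝⁿ`. -/
instance isometryAction (n : ℕ) : MulAction (E n ≃ᵃⁱ[ℝ] E n) (E n) where
  smul g x := g x
  one_smul _ := rfl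
  mul_smul _ _ _ := rfl

/-- The rotational part `B` of the isometry `x ↦ B x + c`. -/
def linearPart (n : ℕ) : (E n ≃ᵃⁱ[ℝ] E n) →* (E n ≃ₗ[ℝ] E n) where
  toFun g := g.linearIsometryEquiv.toLinearEquiv
  map_one' := rfl
  map_mul' _ _ := rfl

/-- The point group of a group of isometries of `ℝⁿ`. -/
def pointGroup {n : ℕ} (Γ : Subgroup (E n ≃ᵃⁱ[ℝ] E n)) : Subgroup (E n ≃ₗ[ℝ] E n) :=
  Γ.map (linearPart n)

/-- `Γ` is discrete (in the topology of pointwise convergence of the isometry group), cocompact and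
torsion-free. -/
structure IsBieberbach {n : ℕ} (Γ : Subgroup (E n ≃ᵃⁱ[ℝ] E n)) : Prop where
  discrete : DiscreteTopology (range fun (γ : Γ) (x : E n) => γ • x)
  cocompact : CompactSpace (MulAction.orbitRel.Quotient Γ (E n))
  torsionFree : ∀ γ : Γ, IsOfFinOrder γ → γ = 1

theorem IsBieberbach.properlyDiscontinuous {n : ℕ} {Γ : Subgroup (E n ≃ᵃⁱ[ℝ] E n)}
    (h : IsBieberbach Γ) : ProperlyDiscontinuousSMul Γ (E n) := by
  have hS := h.discrete
  -- a neighbourhood of the identity, given by finitely many points, that isolates it in `Γ`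
  obtain ⟨F, ε, hε, hF⟩ : ∃ (F : Finset (E n)) (ε : ℝ), 0 < ε ∧
      ∀ γ : Γ, (∀ x ∈ F, dist (γ • x) x < ε) → γ = 1 := by
    have hU := (isOpen_discrete ({⟨fun x => (1 : Γ) • x, mem_range_self 1⟩} :
      Set (range fun (γ : Γ) (x : E n) => γ • x)))
    obtain ⟨U, hUo, hU⟩ := isOpen_induced_iff.1 hU
    have h1 : (fun x => (1 : Γ) • x) ∈ U := by
      have : (⟨fun x => (1 : Γ) • x, mem_range_self 1⟩ :
        range fun (γ : Γ) (x : E n) => γ • x) ∈ Subtype.val ⁻¹' U := by rw [hU]; rfl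
      exact this
    obtain ⟨I, u, hu, hIu⟩ := isOpen_pi_iff.1 hUo _ h1
    have hb : ∀ x : E n, ∃ ε > 0, x ∈ I → Metric.ball x ε ⊆ u x := by
      intro x
      by_cases hx : x ∈ I
      · obtain ⟨ε, h0, hε⟩ := Metric.isOpen_iff.1 (hu x hx).1 _ (hu x hx).2
        exact ⟨ε, h0, fun _ => by simpa using hε⟩
      · exact ⟨1, one_pos, fun h => absurd h hx⟩
    choose r hr0 hr using hb
    obtain ⟨ε, hε, hle⟩ : ∃ ε > 0, ∀ x ∈ I, ε ≤ r x := by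
      rcases I.eq_empty_or_nonempty with rfl | hI
      · exact ⟨1, one_pos, by simp⟩
      · obtain ⟨x, hx, hm⟩ := I.exists_min_image r hI
        exact ⟨r x, hr0 x, hm⟩
    refine ⟨I, ε, hε, fun γ hγ => ?_⟩
    have hmem : (fun x : E n => γ • x) ∈ U := hIu fun x hx =>
      hr x hx (Metric.mem_ball.2 ((hγ x hx).trans_le (hle x hx)))
    have : (⟨fun x => γ • x, mem_range_self γ⟩ :
        range fun (γ : Γ) (x : E n) => γ • x) ∈ Subtype.val ⁻¹' U := hmem
    rw [hU] at this
    have h2 := congrArg Subtype.val (mem_singleton_iff.1 this)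
    apply Subtype.ext
    ext1 x
    exact congrFun h2 x
  constructor
  intro K L hK hL
  let φ : Γ → (F → E n) := fun γ x => γ • (x : E n)
  have hiso : ∀ (γ : Γ) (x y : E n), dist (γ • x) (γ • y) = dist x y := fun γ x y =>
    γ.1.dist_map x y
  have hsep : ∀ γ γ' : Γ, dist (φ γ) (φ γ') < ε → γ = γ' := by
    intro γ γ' hd
    have : γ'⁻¹ * γ = 1 := hF _ fun x hx => by
      have h1 := (dist_le_pi_dist (φ γ) (φ γ') ⟨x, hx⟩).trans_lt hd
      rwa [← hiso γ', smul_smul, mul_inv_cancel_left]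
    rw [inv_mul_eq_one] at this
    exact this.symm
  have hbd : Bornology.IsBounded (φ '' {γ : Γ | ((γ • ·) '' K ∩ L).Nonempty}) := by
    rw [← Bornology.forall_isBounded_image_eval_iff]
    intro x
    obtain ⟨R, hR⟩ := hL.isBounded.subset_closedBall (x : E n)
    obtain ⟨R', hR'⟩ := hK.isBounded.subset_closedBall (x : E n)
    refine (Metric.isBounded_closedBall (x := (x : E n)) (r := R' + R)).subset ?_
    rintro _ ⟨_, ⟨γ, ⟨_, ⟨k, hk, rfl⟩, hkL⟩, rfl⟩, rfl⟩
    have h1 := hR' hk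
    have h2 := hR hkL
    rw [Metric.mem_closedBall] at h1 h2 ⊢
    calc dist (γ • (x : E n)) x ≤ dist (γ • (x : E n)) (γ • k) + dist (γ • k) x :=
          dist_triangle _ _ _
      _ ≤ R' + R := by rw [hiso, dist_comm]; exact add_le_add h1 h2
  have htb : TotallyBounded (φ '' {γ : Γ | ((γ • ·) '' K ∩ L).Nonempty}) :=
    hbd.isCompact_closure.totallyBounded.subset subset_closure
  obtain ⟨t, ht, hcov⟩ := Metric.totallyBounded_iff.1 htb (ε / 2) (half_pos hε)
  have hch : ∀ γ : Γ, ∃ y, ((γ • ·) '' K ∩ L).Nonempty → y ∈ t ∧ dist (φ γ) y < ε / 2 := by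
    intro γ
    by_cases hγ : ((γ • ·) '' K ∩ L).Nonempty
    · have := hcov (mem_image_of_mem φ hγ)
      simp only [mem_iUnion, Metric.mem_ball] at this
      obtain ⟨y, hy, hd⟩ := this
      exact ⟨y, fun _ => ⟨hy, hd⟩⟩
    · exact ⟨0, fun h => absurd h hγ⟩
  choose f hf using hch
  refine Set.Finite.of_injOn (f := f) (t := t) (fun γ hγ => (hf γ hγ).1) ?_ ht
  intro γ hγ γ' hγ' hff
  refine hsep γ γ' ?_
  have h1 := (hf γ hγ).2
  have h2 := (hf γ' hγ').2
  rw [← hff] at h2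
  calc dist (φ γ) (φ γ') ≤ dist (φ γ) (f γ) + dist (φ γ') (f γ) := dist_triangle_right _ _ _
    _ < ε := by linarith

theorem IsBieberbach.isLocalHomeomorph {n : ℕ} {Γ : Subgroup (E n ≃ᵃⁱ[ℝ] E n)} (h : IsBieberbach Γ) :
    IsLocalHomeomorph (Quotient.mk (MulAction.orbitRel Γ (E n))) := by
  have := h.properlyDiscontinuous
  have : ContinuousConstSMul Γ (E n) := ⟨fun γ => γ.1.continuous⟩
  have : IsCancelSMul Γ (E n) := by
    rw [isCancelSMul_iff_eq_one_of_smul_eq]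
    intro γ x hx
    refine h.torsionFree γ (not_not.1 fun hinf => ?_)
    have hinj := injective_pow_iff_not_isOfFinOrder.2 hinf
    refine (Set.infinite_range_of_injective hinj) (Set.Finite.subset
      (ProperlyDiscontinuousSMul.finite_disjoint_inter_image (Γ := Γ)
        (isCompact_singleton (x := x)) (isCompact_singleton (x := x))) ?_)
    rintro _ ⟨k, rfl⟩
    have hk : ∀ k : ℕ, γ ^ k • x = x := by
      intro k
      induction k with
      | zero => simp
      | succ k ih => rw [pow_succ, mul_smul, hx, ih]
    exact ⟨x, ⟨x, rfl, hk k⟩, rfl⟩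
  exact (isQuotientCoveringMap_quotientMk_of_properlyDiscontinuousSMul
    (E := E n) (G := Γ)).isCoveringMap.isLocalHomeomorph

/-- The flat manifold `M_Γ = Γ \ ℝⁿ` of a Bieberbach group. -/
def FlatQuotient {n : ℕ} (Γ : Subgroup (E n ≃ᵃⁱ[ℝ] E n)) (_h : IsBieberbach Γ) : Type :=
  MulAction.orbitRel.Quotient Γ (E n)

instance flatQuotientTop {n : ℕ} (Γ : Subgroup (E n ≃ᵃⁱ[ℝ] E n)) (h : IsBieberbach Γ) :
    TopologicalSpace (FlatQuotient Γ h) :=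
  inferInstanceAs (TopologicalSpace (MulAction.orbitRel.Quotient Γ (E n)))

/-- The charts are local inverses of the projection of `ℝⁿ` to `M_Γ`. -/
instance flatQuotientCharted {n : ℕ} (Γ : Subgroup (E n ≃ᵃⁱ[ℝ] E n)) (h : IsBieberbach Γ) :
    ChartedSpace (E n) (FlatQuotient Γ h) :=
  h.isLocalHomeomorph.chartedSpace Quotient.mk_surjective

/-! ### The two groups -/

/-- The linear isometry of `ℝⁿ` given by an orthogonal matrix. -/
def matrixIsometry {n : ℕ} (A : Matrix (Fin n) (Fin n) ℝ)
    (hA : A ∈ Matrix.orthogonalGroup (Fin n) ℝ) : E n ≃ₗᵢ[ℝ] E n where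
  toFun x := WithLp.toLp 2 (A.mulVec x)
  invFun x := WithLp.toLp 2 (A.transpose.mulVec x)
  map_add' x y := by ext i; simp [Matrix.mulVec_add]
  map_smul' c x := by ext i; simp [Matrix.mulVec_smul]
  left_inv x := by
    have h : A.transpose * A = 1 := (Matrix.mem_orthogonalGroup_iff' _ _).1 hA
    ext i
    simp [Matrix.mulVec_mulVec, h]
  right_inv x := by
    have h : A * A.transpose = 1 := (Matrix.mem_orthogonalGroup_iff _ _).1 hA
    ext i
    simp [Matrix.mulVec_mulVec, h]
  norm_map' x := by
    have h : A.transpose * A = 1 := (Matrix.mem_orthogonalGroup_iff' _ _).1 hA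
    have key : (A.mulVec x) ⬝ᵥ (A.mulVec x) = (x : Fin n → ℝ) ⬝ᵥ x := by
      rw [Matrix.dotProduct_mulVec, Matrix.vecMul_mulVec, h, Matrix.vecMul_one]
    simp only [EuclideanSpace.norm_eq, Real.norm_eq_abs, sq_abs]
    congr 1
    simpa [dotProduct, sq] using key

/-- The translation `L_b : x ↦ x + b`. -/
def translation {n : ℕ} (b : E n) : E n ≃ᵃⁱ[ℝ] E n := AffineIsometryEquiv.constVAdd ℝ (E n) b

/-- The isometry `B L_b : x ↦ B (x + b)`. -/
def motion {n : ℕ} (B : E n ≃ₗᵢ[ℝ] E n) (b : E n) : E n ≃ᵃⁱ[ℝ] E n :=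
  B.toAffineIsometryEquiv * translation b

/-- The translations by the vectors of `ℤⁿ`. -/
def latticeTranslations (n : ℕ) : Set (E n ≃ᵃⁱ[ℝ] E n) :=
  {g | ∃ v : Fin n → ℤ, g = translation (WithLp.toLp 2 fun i => (v i : ℝ))}

theorem mem_orthogonal_one : !![1, 0, 0, 0; 0, 1, 0, 0; 0, 0, -1, 0; 0, 0, 0, -1] ∈
    Matrix.orthogonalGroup (Fin 4) ℝ := by
  rw [Matrix.mem_orthogonalGroup_iff]
  ext i j
  fin_cases i <;> fin_cases j <;> simp [Matrix.mul_apply, Fin.sum_univ_four]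

theorem mem_orthogonal_two : !![1, 0, 0, 0; 0, -1, 0, 0; 0, 0, -1, 0; 0, 0, 0, 1] ∈
    Matrix.orthogonalGroup (Fin 4) ℝ := by
  rw [Matrix.mem_orthogonalGroup_iff]
  ext i j
  fin_cases i <;> fin_cases j <;> simp [Matrix.mul_apply, Fin.sum_univ_four]

theorem mem_orthogonal_three : !![0, 1, 0, 0; -1, 0, 0, 0; 0, 0, -1, 0; 0, 0, 0, 1] ∈
    Matrix.orthogonalGroup (Fin 4) ℝ := by
  rw [Matrix.mem_orthogonalGroup_iff]
  ext i j
  fin_cases i <;> fin_cases j <;> simp [Matrix.mul_apply, Fin.sum_univ_four]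

/-- `Γ = ⟨B₁ L_{e₁/2}, B₂ L_{e₄/2}, ℤ⁴⟩` with `B₁ = diag(1, 1, -1, -1)` and
`B₂ = diag(1, -1, -1, 1)`. -/
def groupOne : Subgroup (E 4 ≃ᵃⁱ[ℝ] E 4) :=
  Subgroup.closure ({motion (matrixIsometry _ mem_orthogonal_one) !₂[1 / 2, 0, 0, 0],
    motion (matrixIsometry _ mem_orthogonal_two) !₂[0, 0, 0, 1 / 2]} ∪ latticeTranslations 4)

/-- `Γ' = ⟨B' L_{e₄/4}, ℤ⁴⟩` with `B' = diag(J, -1, 1)`, `J = [0, 1; -1, 0]`. -/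
def groupTwo : Subgroup (E 4 ≃ᵃⁱ[ℝ] E 4) :=
  Subgroup.closure ({motion (matrixIsometry _ mem_orthogonal_three) !₂[0, 0, 0, 1 / 4]} ∪
    latticeTranslations 4)

end FlatGeom

end

open FlatGeom

noncomputable section

namespace FlatGeom

/-! ### The Weitzenböck formula on flat space -/

section Weitzenboeck

variable {n p : ℕ}

/-! A form on Γ\ℝ⁴ is the same as a Γ-invariant form on ℝ⁴ (`rank_eigenforms_eq`), and on flat space
the Hodge-Laplace operator acts on each coefficient as -Δ (`hodgeLaplacian_eq_neg_laplacian`). So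
the eigenforms for `l` are the invariants of Γ in V ⊗ Λᵖ, where V, `periodicEigenfunctions l`,
collects the ℤ⁴-periodic functions with -Δf = l f and Λᵖ the constant complex p-forms. Translations
by ℤ⁴ act trivially on both factors, and only the point group F, of order 4, remains to be imposed.

For p = 1 and p = 3 the space Λᵖ has dimension 4 = |F|, and the traces of the nontrivial elements
vanish; hence Λᵖ is the regular representation of F, and (V ⊗ ℂ[F])^F ≅ V whatever the action of F
on V is. Both manifolds therefore have multiplicity dim V. The proof writes the isomorphism down:
the coefficients of a form are paired with a functional whose translates under F span the dual of
Λᵖ, and the inverse is built from the isotypic projections of a function in V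
(`rank_invariantForms_groupOne`, `rank_invariantForms_groupTwo`). No finiteness of dim V is needed,
and the traces are proved separately, by conjugating B to -B.

The holonomy is found by lifting loops (`setOf_isParallelTransport`). Tangent spaces are read in
preferred charts, in which the projection is, near each point y, an element of Γ, `chartMotion h y`;
parallel fields are the images of constant fields on ℝⁿ. Torsion-freeness comes from coordinates
that an element only shifts (`groupOne_structure`, `groupTwo_structure`). -/

theorem contDiff_fderiv_infty {F : Type*} [NormedAddCommGroup F] [NormedSpace ℝ F]
    {f : E n → F} (hf : ContDiff ℝ ∞ f) : ContDiff ℝ ∞ (fderiv ℝ f) :=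
  hf.fderiv_right (by simp)

theorem hasFDerivAt_clm_fderiv {V F G : Type*} [NormedAddCommGroup V] [NormedSpace ℝ V]
    [NormedAddCommGroup F] [NormedSpace ℝ F] [NormedAddCommGroup G] [NormedSpace ℝ G]
    {f : V → F} {x : V} (L : (V →L[ℝ] F) →L[ℝ] G) (h : DifferentiableAt ℝ (fderiv ℝ f) x) :
    HasFDerivAt (fun x => L (fderiv ℝ f x)) (L.comp (fderiv ℝ (fderiv ℝ f) x)) x :=
  L.hasFDerivAt.comp x h.hasFDerivAt

theorem fderiv_extDeriv_apply {η : E n → E n [⋀^Fin p]→L[ℝ] ℂ} (hη : ContDiff ℝ ∞ η) (x w : E n)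
    (v : Fin (p + 1) → E n) :
    fderiv ℝ (extDeriv η) x w v =
      ∑ i : Fin (p + 1), (-1 : ℤ) ^ (i : ℕ) • fderiv ℝ (fderiv ℝ η) x w (v i) (i.removeNth v) := by
  have h2 : DifferentiableAt ℝ (fderiv ℝ η) x :=
    (contDiff_fderiv_infty hη).differentiable (by simp) x
  have h : HasFDerivAt (extDeriv η) ((ContinuousAlternatingMap.alternatizeUncurryFinCLM ℝ (E n) ℂ
      (n := p)).comp (fderiv ℝ (fderiv ℝ η) x)) x :=
    hasFDerivAt_clm_fderiv (ContinuousAlternatingMap.alternatizeUncurryFinCLM ℝ (E n) ℂ) h2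
  rw [h.fderiv]
  simp [ContinuousAlternatingMap.alternatizeUncurryFin_apply]

theorem fderiv_codiff_apply {η : E n → E n [⋀^Fin (p + 1)]→L[ℝ] ℂ} (hη : ContDiff ℝ ∞ η)
    (x w : E n) (v : Fin p → E n) :
    fderiv ℝ (codiff η) x w v =
      -∑ i : Fin n, fderiv ℝ (fderiv ℝ η) x w (EuclideanSpace.single i 1)
        (Fin.cons (EuclideanSpace.single i 1) v) := by
  have h2 : DifferentiableAt ℝ (fderiv ℝ η) x :=
    (contDiff_fderiv_infty hη).differentiable (by simp) x
  -- Each summand of the codifferential is a fixed continuous linear map of the derivative of η, so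
  -- differentiating it only needs the chain rule.
  let L (i : Fin n) : (E n →L[ℝ] E n [⋀^Fin (p + 1)]→L[ℝ] ℂ) →L[ℝ] E n [⋀^Fin p]→L[ℝ] ℂ :=
    (ContinuousLinearMap.apply ℝ (E n [⋀^Fin p]→L[ℝ] ℂ) (EuclideanSpace.single i (1 : ℝ))).comp
      ((ContinuousAlternatingMap.curryLeftLI (𝕜 := ℝ) (E := E n) (F := ℂ)
        (n := p)).toContinuousLinearMap.comp
        (ContinuousLinearMap.apply ℝ (E n [⋀^Fin (p + 1)]→L[ℝ] ℂ)
          (EuclideanSpace.single i (1 : ℝ))))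
  have h : HasFDerivAt (codiff η) (-∑ i : Fin n, (L i).comp (fderiv ℝ (fderiv ℝ η) x)) x :=
    (HasFDerivAt.fun_sum fun i _ => hasFDerivAt_clm_fderiv (L i) h2).neg
  rw [h.fderiv]
  simp only [L, ContinuousLinearMap.comp_apply, neg_apply,
    sum_apply, ContinuousAlternatingMap.neg_apply, ContinuousAlternatingMap.sum_apply]
  rfl

theorem removeNth_succ_cons {α : Type*} (j : Fin (p + 1)) (a : α) (v : Fin (p + 1) → α) :
    Fin.removeNth (α := fun _ => α) j.succ (Fin.cons a v) =
      Fin.cons a (Fin.removeNth (α := fun _ => α) j v) := by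
  funext k
  refine Fin.cases ?_ (fun k => ?_) k
  · simp [Fin.removeNth]
  · simp [Fin.removeNth]

theorem codiff_extDeriv_apply {η : E n → E n [⋀^Fin p]→L[ℝ] ℂ} (hη : ContDiff ℝ ∞ η) (x : E n)
    (v : Fin p → E n) :
    codiff (extDeriv η) x v = -∑ i : Fin n, ∑ j : Fin (p + 1), (-1 : ℤ) ^ (j : ℕ) •
      fderiv ℝ (fderiv ℝ η) x (EuclideanSpace.single i 1)
        ((Fin.cons (EuclideanSpace.single i 1) v : Fin (p + 1) → E n) j)
        (Fin.removeNth (α := fun _ => E n) j (Fin.cons (EuclideanSpace.single i 1) v)) := by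
  simp only [codiff, ContinuousAlternatingMap.neg_apply, ContinuousAlternatingMap.sum_apply,
    ContinuousAlternatingMap.curryLeft_apply_apply]
  congr 1
  exact Finset.sum_congr rfl fun i _ => fderiv_extDeriv_apply hη x _ _

theorem laplacian_apply_eq_sum {F : Type*} [NormedAddCommGroup F] [NormedSpace ℝ F]
    (f : E n → F) (x : E n) :
    Laplacian.laplacian f x = ∑ i : Fin n, fderiv ℝ (fderiv ℝ f) x (EuclideanSpace.single i 1)
      (EuclideanSpace.single i 1) := by
  rw [InnerProductSpace.laplacian_eq_iteratedFDeriv_orthonormalBasis f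
    (EuclideanSpace.basisFun (Fin n) ℝ)]
  simp [iteratedFDeriv_two_apply]

/-- On flat space `dδ + δd` is minus the Laplacian of the coefficients. -/
theorem hodgeLaplacian_eq_neg_laplacian : ∀ {p : ℕ} {η : E n → E n [⋀^Fin p]→L[ℝ] ℂ},
    ContDiff ℝ ∞ η → ∀ x, hodgeLaplacian η x = -Laplacian.laplacian η x
  | 0, η, hη, x => by
    ext v
    rw [hodgeLaplacian, codiff_extDeriv_apply hη, laplacian_apply_eq_sum]
    simp only [Fin.sum_univ_succ, Finset.univ_eq_empty, Finset.sum_empty,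
      ContinuousAlternatingMap.neg_apply, ContinuousAlternatingMap.sum_apply]
    congr 1
    refine Finset.sum_congr rfl fun i _ => ?_
    simp
  | p + 1, η, hη, x => by
    ext v
    -- The symmetry of second derivatives makes the mixed terms of dδ and δd cancel.
    have hsymm : ∀ a b, fderiv ℝ (fderiv ℝ η) x a b = fderiv ℝ (fderiv ℝ η) x b a :=
      (hη.contDiffAt (x := x)).isSymmSndFDerivAt
        (by rw [minSmoothness_of_isRCLikeNormedField]; exact WithTop.coe_le_coe.2 le_top)
    rw [hodgeLaplacian, ContinuousAlternatingMap.add_apply, codiff_extDeriv_apply hη,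
      laplacian_apply_eq_sum, extDeriv,
      ContinuousAlternatingMap.alternatizeUncurryFin_apply]
    simp only [fderiv_codiff_apply hη, ContinuousAlternatingMap.neg_apply,
      ContinuousAlternatingMap.sum_apply]
    -- In δd the term j = 0 pairs eᵢ with itself and gives -Δ; the terms with j > 0 are those of dδ
    -- with the opposite sign.
    simp only [Fin.sum_univ_succ (n := p + 1), removeNth_succ_cons, Fin.cons_zero, Fin.cons_succ,
      Fin.val_succ, pow_succ, mul_neg_one, neg_smul, Finset.sum_add_distrib, Finset.sum_neg_distrib,
      smul_neg, Fin.val_zero, pow_zero, one_smul, neg_add, neg_neg]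
    rw [add_left_comm]
    have h1 : ∀ i : Fin n, Fin.removeNth (α := fun _ => E n) 0
        (Fin.cons (EuclideanSpace.single i (1 : ℝ)) v) = v := fun i => rfl
    simp only [h1]
    rw [add_eq_left, Finset.sum_comm, neg_add_eq_zero]
    refine Finset.sum_congr rfl fun j _ => ?_
    rw [Finset.smul_sum]
    exact Finset.sum_congr rfl fun i _ => by rw [hsymm]

theorem laplacian_comp_isometry {F : Type*} [NormedAddCommGroup F] [NormedSpace ℝ F]
    {f : E n → F} (hf : ContDiff ℝ ∞ f) (g : E n ≃ᵃⁱ[ℝ] E n) (x : E n) :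
    Laplacian.laplacian (f ∘ g) x = Laplacian.laplacian f (g x) := by
  let A : E n →L[ℝ] E n := g.linearIsometryEquiv.toContinuousLinearEquiv
  have hg : ∀ y, HasFDerivAt g A y := fun y => by
    have h : (g : E n → E n) = fun z => A z + g 0 := by
      funext z
      have := g.map_vadd 0 z
      simpa [A] using this
    rw [h]
    exact A.hasFDerivAt.add_const _
  have h1 : fderiv ℝ (f ∘ g) = fun y =>
      ((ContinuousLinearMap.compL ℝ (E n) (E n) F).flip A) (fderiv ℝ f (g y)) := by
    funext y
    exact (((hf.differentiable (by simp)) (g y)).hasFDerivAt.comp y (hg y)).fderiv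
  have h2 : HasFDerivAt (fderiv ℝ f) (fderiv ℝ (fderiv ℝ f) (g x)) (g x) :=
    ((contDiff_fderiv_infty hf).differentiable (by simp) (g x)).hasFDerivAt
  have h3 := (((ContinuousLinearMap.compL ℝ (E n) (E n) F).flip A).hasFDerivAt.comp x
    (h2.comp x (hg x))).fderiv
  rw [laplacian_apply_eq_sum, h1]
  rw [Function.comp_def] at h3
  simp only [Function.comp_def] at h3
  rw [h3]
  -- The Laplacian at `g x` is computed in the image under `g` of the standard basis, which is again
  -- orthonormal.
  rw [InnerProductSpace.laplacian_eq_iteratedFDeriv_orthonormalBasis f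
    ((EuclideanSpace.basisFun (Fin n) ℝ).map g.linearIsometryEquiv)]
  simp [iteratedFDeriv_two_apply, A]

end Weitzenboeck

/-! ### Geometry of the quotient by a Bieberbach group -/

section Quotient

variable {n : ℕ}

/-- The derivative of an isometry of `ℝⁿ`. -/
def lin (g : E n ≃ᵃⁱ[ℝ] E n) : E n →L[ℝ] E n :=
  (g.linearIsometryEquiv.toContinuousLinearEquiv : E n →L[ℝ] E n)

theorem lin_apply (g : E n ≃ᵃⁱ[ℝ] E n) (v : E n) : lin g v = linearPart n g v := rfl

theorem lin_mul (g g' : E n ≃ᵃⁱ[ℝ] E n) : lin (g * g') = (lin g).comp (lin g') := rfl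

theorem lin_one : lin (1 : E n ≃ᵃⁱ[ℝ] E n) = ContinuousLinearMap.id ℝ (E n) := rfl

theorem apply_eq_lin_add (g : E n ≃ᵃⁱ[ℝ] E n) (x : E n) : g x = lin g x + g 0 := by
  have := g.map_vadd 0 x
  simpa [lin] using this

theorem hasFDerivAt_isometry (g : E n ≃ᵃⁱ[ℝ] E n) (x : E n) : HasFDerivAt g (lin g) x := by
  rw [show (g : E n → E n) = fun z => lin g z + g 0 from funext (apply_eq_lin_add g)]
  exact (lin g).hasFDerivAt.add_const _

theorem contDiff_isometry (g : E n ≃ᵃⁱ[ℝ] E n) : ContDiff ℝ ∞ g := by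
  rw [show (g : E n → E n) = fun z => lin g z + g 0 from funext (apply_eq_lin_add g)]
  exact (lin g).contDiff.add contDiff_const

variable {Γ : Subgroup (E n ≃ᵃⁱ[ℝ] E n)} (h : IsBieberbach Γ)

theorem coe_smul_eq (γ : Γ) (y : E n) : γ • y = γ.1 y := rfl

instance continuousConstSMul_isometrySubgroup : ContinuousConstSMul Γ (E n) :=
  ⟨fun γ => γ.1.continuous⟩

/-- By proper discontinuity stabilizers of points are finite, so an element with a fixed point has
finite order and is trivial. -/
theorem IsBieberbach.isCancelSMul (h : IsBieberbach Γ) : IsCancelSMul Γ (E n) := by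
  have := h.properlyDiscontinuous
  rw [isCancelSMul_iff_eq_one_of_smul_eq]
  intro γ x hx
  refine h.torsionFree γ (not_not.1 fun hinf => ?_)
  have hinj := injective_pow_iff_not_isOfFinOrder.2 hinf
  refine (Set.infinite_range_of_injective hinj) (Set.Finite.subset
    (ProperlyDiscontinuousSMul.finite_disjoint_inter_image (Γ := Γ)
      (isCompact_singleton (x := x)) (isCompact_singleton (x := x))) ?_)
  rintro _ ⟨k, rfl⟩
  have hk : ∀ k : ℕ, γ ^ k • x = x := by
    intro k
    induction k with
    | zero => simp
    | succ k ih => rw [pow_succ, mul_smul, hx, ih]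
  exact ⟨x, ⟨x, rfl, hk k⟩, rfl⟩

theorem IsBieberbach.eq_of_smul_eq (h : IsBieberbach Γ) {γ γ' : Γ} {y : E n} (hy : γ • y = γ' • y) :
    γ = γ' :=
  have := h.isCancelSMul
  IsCancelSMul.right_cancel γ γ' y hy

/-- The projection of `ℝⁿ` to the flat manifold `M_Γ`. -/
def proj (y : E n) : FlatQuotient Γ h := Quotient.mk (MulAction.orbitRel Γ (E n)) y

theorem proj_surjective : Function.Surjective (proj h) := Quotient.mk_surjective

theorem proj_eq_iff {y z : E n} : proj h y = proj h z ↔ ∃ γ : Γ, γ • z = y :=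
  Quotient.eq (r := MulAction.orbitRel Γ (E n))

theorem proj_smul (γ : Γ) (y : E n) : proj h (γ • y) = proj h y := (proj_eq_iff h).2 ⟨γ, rfl⟩

theorem isCoveringMap_proj : IsCoveringMap (proj h) := by
  have := h.properlyDiscontinuous
  have := h.isCancelSMul
  exact (isQuotientCoveringMap_quotientMk_of_properlyDiscontinuousSMul
    (E := E n) (G := Γ)).isCoveringMap

theorem continuous_proj : Continuous (proj h) := continuous_quot_mk

/-- This is an equality of total functions, valid off the target too; it lets one expression on ℝⁿ
represent a form in every chart. -/
theorem atlas_symm_eq_proj {e : OpenPartialHomeomorph (FlatQuotient Γ h) (E n)}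
    (he : e ∈ atlas (E n) (FlatQuotient Γ h)) : ⇑e.symm = proj h := by
  obtain ⟨q, rfl⟩ := he
  exact h.isLocalHomeomorph.localInverseAt_symm _

/-- `e (proj h y)` lies over the same point as `y`, so it is `γ • y`. The same γ serves nearby
points because γ maps a neighbourhood of `y` into the open target, where `e` inverts the projection.
-/
theorem exists_chart_eventuallyEq {e : OpenPartialHomeomorph (FlatQuotient Γ h) (E n)}
    (he : e ∈ atlas (E n) (FlatQuotient Γ h)) {y : E n} (hy : proj h y ∈ e.source) :
    ∃ γ : Γ, ∀ᶠ z in 𝓝 y, proj h z ∈ e.source ∧ e (proj h z) = γ • z := by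
  have hs := atlas_symm_eq_proj h he
  have h1 : proj h (e (proj h y)) = proj h y := (congrFun hs _).symm.trans (e.left_inv hy)
  obtain ⟨γ, hγ⟩ := (proj_eq_iff h).1 h1
  have h2 : γ • y ∈ e.target := by rw [hγ]; exact e.map_source hy
  refine ⟨γ, ((continuous_const_smul γ).continuousAt.eventually
    (e.open_target.mem_nhds h2)).mono fun z hz => ?_⟩
  have h3 : proj h z = e.symm (γ • z) := by rw [hs, proj_smul]
  rw [h3]
  exact ⟨e.map_target hz, e.right_inv hz⟩

/-- The element of `Γ` that moves `y` to the image of its class in the preferred chart there. -/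
def chartMotion (y : E n) : Γ :=
  (exists_chart_eventuallyEq h (chart_mem_atlas (E n) (proj h y))
    (mem_chart_source (E n) (proj h y))).choose

theorem chartMotion_eventually (y : E n) : ∀ᶠ z in 𝓝 y,
    chartAt (E n) (proj h y) (proj h z) = chartMotion h y • z :=
  ((exists_chart_eventuallyEq h (chart_mem_atlas (E n) (proj h y))
    (mem_chart_source (E n) (proj h y))).choose_spec).mono fun _ hz => hz.2

theorem chartMotion_smul_self (y : E n) :
    chartMotion h y • y = chartAt (E n) (proj h y) (proj h y) :=
  (chartMotion_eventually h y).self_of_nhds.symm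

/-- Both sides send `y` to the same chart value, and the action is free. -/
theorem chartMotion_smul (γ : Γ) (y : E n) : chartMotion h (γ • y) * γ = chartMotion h y := by
  refine h.eq_of_smul_eq (y := y) ?_
  rw [mul_smul, chartMotion_smul_self, chartMotion_smul_self, proj_smul]

/-- The tangent space at `proj h y` is `E n` by way of the preferred chart, in which the projection
reads as `chartMotion h y` near `y`. -/
theorem hasMFDerivAt_proj (y : E n) :
    HasMFDerivAt 𝓘(ℝ, E n) 𝓘(ℝ, E n) (proj h) y (lin (chartMotion h y).1) := by
  refine ⟨(continuous_proj h).continuousAt, ?_⟩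
  have h1 := (hasFDerivAt_isometry (chartMotion h y).1 y).congr_of_eventuallyEq
    (chartMotion_eventually h y)
  exact h1.hasFDerivWithinAt

theorem hasMFDerivAt_chart {e : OpenPartialHomeomorph (FlatQuotient Γ h) (E n)}
    (he : e ∈ atlas (E n) (FlatQuotient Γ h)) {y : E n} (hy : proj h y ∈ e.source) {γ : Γ}
    (hγ : e (proj h y) = γ • y) :
    HasMFDerivAt 𝓘(ℝ, E n) 𝓘(ℝ, E n) e (proj h y) (lin (γ * (chartMotion h y)⁻¹).1) := by
  refine ⟨(e.continuousAt hy), ?_⟩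
  have hy' : proj h (chartMotion h y • y) ∈ e.source := by rwa [proj_smul]
  obtain ⟨γ', hγ'⟩ := exists_chart_eventuallyEq h he hy'
  have h2 : γ' = γ * (chartMotion h y)⁻¹ := by
    refine h.eq_of_smul_eq (y := chartMotion h y • y) ?_
    rw [← hγ'.self_of_nhds.2, proj_smul, hγ, smul_smul, inv_mul_cancel_right]
  subst h2
  have h1 := (hasFDerivAt_isometry (γ * (chartMotion h y)⁻¹).1
    (chartMotion h y • y)).congr_of_eventuallyEq (hγ'.mono fun z hz => hz.2)
  rw [chartMotion_smul_self] at h1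
  have h3 := atlas_symm_eq_proj h (chart_mem_atlas (E n) (proj h y))
  have h4 : writtenInExtChartAt 𝓘(ℝ, E n) 𝓘(ℝ, E n) (proj h y) e = fun z => e (proj h z) := by
    funext z
    exact congrArg e (congrFun h3 z)
  rw [h4]
  exact h1.hasFDerivWithinAt

/-! #### The quotient is a closed flat manifold -/

theorem isClosedFlatManifold_flatQuotient : IsClosedFlatManifold n (FlatQuotient Γ h) := by
  have := h.properlyDiscontinuous
  refine ⟨?_, ?_, h.cocompact, ?_, ?_⟩
  · exact inferInstanceAs (T2Space (Quotient (MulAction.orbitRel Γ (E n))))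
  · exact ContinuousConstSMul.secondCountableTopology (Γ := Γ) (T := E n)
  · exact (proj_surjective h).connectedSpace (continuous_proj h)
  · intro e he e' he' y hy
    have hs := atlas_symm_eq_proj h he
    have hy' : proj h y ∈ e'.source := by
      rw [OpenPartialHomeomorph.trans_source] at hy
      rw [← hs]
      exact hy.2
    obtain ⟨γ, hγ⟩ := exists_chart_eventuallyEq h he' hy'
    refine ⟨γ.1, ?_⟩
    rw [hs]
    exact hγ.mono fun z hz => hz.2

/-! #### Holonomy -/

theorem chartVec_eq {e : OpenPartialHomeomorph (FlatQuotient Γ h) (E n)}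
    (he : e ∈ atlas (E n) (FlatQuotient Γ h)) {x : FlatQuotient Γ h} {y : E n}
    (hx : x = proj h y) (hy : proj h y ∈ e.source) {γ : Γ}
    (hγ : e (proj h y) = γ • y) (v : E n) :
    chartVec e x v = lin γ.1 (lin (chartMotion h y).1⁻¹ v) := by
  subst hx
  exact DFunLike.congr_fun (hasMFDerivAt_chart h he hy hγ).mfderiv v

theorem lin_inv_apply_self (g : E n ≃ᵃⁱ[ℝ] E n) (v : E n) : lin g⁻¹ (lin g v) = v := by
  rw [← ContinuousLinearMap.comp_apply, ← lin_mul, inv_mul_cancel, lin_one]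
  rfl

theorem lin_apply_inv_self (g : E n ≃ᵃⁱ[ℝ] E n) (v : E n) : lin g (lin g⁻¹ v) = v := by
  rw [← ContinuousLinearMap.comp_apply, ← lin_mul, mul_inv_cancel, lin_one]
  rfl

/-- Along the projection of a path in `ℝⁿ`, parallel fields are the images of constant ones. -/
theorem isParallelAlong_proj_iff {x y : FlatQuotient Γ h} (c : Path x y) (d : unitInterval → E n)
    (hd : Continuous d) (hc : ∀ t, c t = proj h (d t)) (X : unitInterval → E n) :
    IsParallelAlong c (X : (t : unitInterval) → TangentSpace 𝓘(ℝ, E n) (c t)) ↔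
      ∀ t, X t = lin (chartMotion h (d t)).1 (lin (chartMotion h (d 0)).1⁻¹ (X 0)) := by
  constructor
  · intro hX
    -- Pulled back to ℝⁿ, the field is locally constant, because one γ describes the chart near `d
    -- t`; it is then constant since the interval is connected.
    have hloc : IsLocallyConstant fun t => lin (chartMotion h (d t)).1⁻¹ (X t) := by
      rw [IsLocallyConstant.iff_eventually_eq]
      intro t
      have he := chart_mem_atlas (E n) (proj h (d t))
      have hsrc := mem_chart_source (E n) (proj h (d t))
      obtain ⟨γ, hγ⟩ := exists_chart_eventuallyEq h he hsrc
      have h1 := hX _ he t (by rw [hc]; exact hsrc)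
      have h2 := hd.continuousAt.eventually hγ
      filter_upwards [h1, h2] with s hs1 hs2
      rw [chartVec_eq h he (hc s) hs2.1 hs2.2,
        chartVec_eq h he (hc t) hsrc hγ.self_of_nhds.2] at hs1
      have h3 := congrArg (lin γ.1⁻¹) hs1
      simpa only [lin_inv_apply_self] using h3
    intro t
    rw [← hloc.apply_eq_of_preconnectedSpace t 0, lin_apply_inv_self]
  · intro hX e he t ht
    rw [hc] at ht
    obtain ⟨γ, hγ⟩ := exists_chart_eventuallyEq h he ht
    have h2 := hd.continuousAt.eventually hγ
    filter_upwards [h2] with s hs2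
    rw [chartVec_eq h he (hc s) hs2.1 hs2.2, chartVec_eq h he (hc t) ht hγ.self_of_nhds.2,
      hX t, hX s,
      lin_inv_apply_self, lin_inv_apply_self]

theorem isParallelTransport_iff {x : FlatQuotient Γ h} (c : Path x x) (d : unitInterval → E n)
    (hd : Continuous d) (hc : ∀ t, c t = proj h (d t)) (A : E n ≃ₗ[ℝ] E n) :
    IsParallelTransport (n := n) c A ↔
      ∀ v, A v = lin (chartMotion h (d 1)).1 (lin (chartMotion h (d 0)).1⁻¹ v) := by
  constructor
  · intro hA v
    obtain ⟨X, hX, h0, h1⟩ := hA v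
    have h0' : (X 0 : E n) = v := eq_of_heq h0
    have h1' : (X 1 : E n) = A v := eq_of_heq h1
    have h2 := (isParallelAlong_proj_iff h c d hd hc X).1 hX 1
    rw [← h1', ← h0']
    exact h2
  · intro hA v
    let X : unitInterval → E n := fun t =>
      lin (chartMotion h (d t)).1 (lin (chartMotion h (d 0)).1⁻¹ v)
    have hX0 : X 0 = v := lin_apply_inv_self _ _
    refine ⟨X, (isParallelAlong_proj_iff h c d hd hc X).2 fun t => ?_, heq_of_eq hX0,
      heq_of_eq (hA v).symm⟩
    rw [hX0]

/-- A loop lifts to a path between two points of one fibre, and its transport is the rotational part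
of a quotient of two chart motions, both in Γ. Conversely every element of Γ arises by choosing the
endpoint of the lift. -/
theorem setOf_isParallelTransport (x : FlatQuotient Γ h) :
    {A : E n ≃ₗ[ℝ] E n | ∃ c : Path x x, IsParallelTransport (n := n) c A} = pointGroup Γ := by
  obtain ⟨y, rfl⟩ := proj_surjective h x
  ext A
  constructor
  · rintro ⟨c, hc⟩
    obtain ⟨d, hd, hd'⟩ := (isCoveringMap_proj h).exists_path_lifts c.toContinuousMap y
      (by simp)
    have hcd : ∀ t, c t = proj h (d t) := fun t => (congrFun hd t).symm
    refine ⟨(chartMotion h (d 1)).1 * (chartMotion h (d 0)).1⁻¹,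
      Γ.mul_mem (chartMotion h (d 1)).2 (Γ.inv_mem (chartMotion h (d 0)).2), ?_⟩
    refine LinearEquiv.ext fun v => ?_
    rw [(isParallelTransport_iff h c d d.continuous hcd A).1 hc v]
    rfl
  · rintro ⟨g, hg, rfl⟩
    -- the loop is the projection of the segment from `y` to its translate by a conjugate of `g⁻¹`
    let γ : Γ := (chartMotion h y)⁻¹ * ⟨g, hg⟩⁻¹ * chartMotion h y
    let d : Path y (γ • y) := (PathConnectedSpace.joined y (γ • y)).somePath
    have hend : proj h y = proj h (γ • y) := (proj_smul h γ y).symm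
    refine ⟨(d.map (continuous_proj h)).cast rfl hend,
      (isParallelTransport_iff h _ d d.continuous (fun t => rfl) _).2 fun v => ?_⟩
    -- By equivariance the chart motion at `γ • y` is that at `y` times γ⁻¹; γ is chosen to make
    -- this the left multiple by `g`.
    have h1 : chartMotion h (d 1) = ⟨g, hg⟩ * chartMotion h y := by
      rw [d.target, ← mul_inv_eq_iff_eq_mul.2 (chartMotion_smul h γ y).symm]
      simp [γ, mul_assoc]
    rw [h1, d.source, ← ContinuousLinearMap.comp_apply, ← lin_mul]
    simp [mul_assoc, lin_apply]

/-- In the preferred charts the holonomy groups of `M_Γ` are the point group of `Γ`. -/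
theorem holonomyGroup_eq (x : FlatQuotient Γ h) :
    (holonomyGroup n x : Subgroup (E n ≃ₗ[ℝ] E n)) = pointGroup Γ := by
  have h1 : (holonomyGroup n x : Subgroup (E n ≃ₗ[ℝ] E n)) = Subgroup.closure
    {A : E n ≃ₗ[ℝ] E n | ∃ c : Path x x, IsParallelTransport (n := n) c A} := rfl
  rw [h1, setOf_isParallelTransport, Subgroup.closure_eq]

end Quotient

/-! ### Eigenforms on the quotient are invariant eigenforms on `ℝⁿ` -/

section Eigenforms

variable {n p : ℕ}

/-- The pullback of constant forms by a linear map. -/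
def pullCLM (A : E n →L[ℝ] E n) :
    (E n [⋀^Fin p]→L[ℝ] ℂ) →L[ℝ] (E n [⋀^Fin p]→L[ℝ] ℂ) :=
  ContinuousAlternatingMap.compContinuousLinearMapCLM A

theorem pullCLM_mul (g g' : E n ≃ᵃⁱ[ℝ] E n) (α : E n [⋀^Fin p]→L[ℝ] ℂ) :
    pullCLM (lin (g * g')) α = pullCLM (lin g') (pullCLM (lin g) α) := rfl

theorem pullCLM_one (α : E n [⋀^Fin p]→L[ℝ] ℂ) :
    pullCLM (lin (1 : E n ≃ᵃⁱ[ℝ] E n)) α = α := rfl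

theorem pullCLM_inv_pullCLM (g : E n ≃ᵃⁱ[ℝ] E n) (α : E n [⋀^Fin p]→L[ℝ] ℂ) :
    pullCLM (lin g⁻¹) (pullCLM (lin g) α) = α := by
  rw [← pullCLM_mul, mul_inv_cancel, pullCLM_one]

theorem pullCLM_pullCLM_inv (g : E n ≃ᵃⁱ[ℝ] E n) (α : E n [⋀^Fin p]→L[ℝ] ℂ) :
    pullCLM (lin g) (pullCLM (lin g⁻¹) α) = α := by
  rw [← pullCLM_mul, inv_mul_cancel, pullCLM_one]

theorem laplacian_smul_complex {F : Type*} [NormedAddCommGroup F] [NormedSpace ℝ F] [Module ℂ F]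
    [ContinuousConstSMul ℂ F] [SMulCommClass ℝ ℂ F] (c : ℂ) {f : E n → F}
    (hf : ContDiff ℝ ∞ f) (x : E n) :
    Laplacian.laplacian (c • f) x = c • Laplacian.laplacian f x := by
  let L : F →L[ℝ] F := c • ContinuousLinearMap.id ℝ F
  exact (hf.contDiffAt.of_le (WithTop.coe_le_coe.2 le_top)).laplacian_CLM_comp_left (l := L)

variable (p) in
/-- The smooth `p`-forms `α` on `ℝⁿ` that are invariant under `Γ` and satisfy `-Δα = l α`. -/
def invariantForms (Γ : Subgroup (E n ≃ᵃⁱ[ℝ] E n)) (l : ℂ) :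
    Submodule ℂ (E n → E n [⋀^Fin p]→L[ℝ] ℂ) where
  carrier := {α | ContDiff ℝ ∞ α ∧ (∀ g ∈ Γ, ∀ y, pullCLM (lin g) (α (g y)) = α y) ∧
    ∀ y, -Laplacian.laplacian α y = l • α y}
  zero_mem' := by
    refine ⟨contDiff_const, fun g _ y => map_zero _, fun y => ?_⟩
    rw [show (0 : E n → E n [⋀^Fin p]→L[ℝ] ℂ) = fun _ => 0 from rfl]
    simp
    exact (smul_zero _).symm
  add_mem' := by
    rintro a b ⟨ha, ha', ha''⟩ ⟨hb, hb', hb''⟩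
    refine ⟨ha.add hb, fun g hg y => ?_, fun y => ?_⟩
    · rw [Pi.add_apply, map_add, ha' g hg, hb' g hg, Pi.add_apply]
    · rw [(ha.contDiffAt.of_le (WithTop.coe_le_coe.2 le_top)).laplacian_add
        (hb.contDiffAt.of_le (WithTop.coe_le_coe.2 le_top)), neg_add, ha'', hb'', Pi.add_apply,
        smul_add]
  smul_mem' := by
    rintro c a ⟨ha, ha', ha''⟩
    refine ⟨ha.const_smul c, fun g hg y => ?_, fun y => ?_⟩
    · rw [Pi.smul_apply, Pi.smul_apply, ← ha' g hg y]
      rfl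
    · rw [laplacian_smul_complex c ha, Pi.smul_apply, ← smul_neg, ha'', smul_comm]

variable {Γ : Subgroup (E n ≃ᵃⁱ[ℝ] E n)} (h : IsBieberbach Γ)

/-- The pullback to `ℝⁿ` of a form on the quotient. -/
def pullForm (η : RoughForm n (FlatQuotient Γ h) p) (y : E n) : E n [⋀^Fin p]→L[ℝ] ℂ :=
  pullCLM (lin (chartMotion h y).1) (η (proj h y))

theorem chartRep_eq_pullForm {e : OpenPartialHomeomorph (FlatQuotient Γ h) (E n)}
    (he : e ∈ atlas (E n) (FlatQuotient Γ h)) (η : RoughForm n (FlatQuotient Γ h) p) :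
    chartRep e η = pullForm h η := by
  have hs := atlas_symm_eq_proj h he
  funext y
  rw [chartRep, hs, (hasMFDerivAt_proj h y).mfderiv]
  rfl

theorem pullForm_invariant (η : RoughForm n (FlatQuotient Γ h) p) {g : E n ≃ᵃⁱ[ℝ] E n}
    (hg : g ∈ Γ) (y : E n) : pullCLM (lin g) (pullForm h η (g y)) = pullForm h η y := by
  -- All the fibres are the same space `E n [⋀^Fin p]→L[ℝ] ℂ`, so values of η at equal points may be
  -- compared directly.
  have h1 : ∀ x x' : FlatQuotient Γ h, x = x' →
      (η x : E n [⋀^Fin p]→L[ℝ] ℂ) = (η x' : E n [⋀^Fin p]→L[ℝ] ℂ) := by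
    rintro x _ rfl
    rfl
  rw [pullForm, pullForm, ← chartMotion_smul h ⟨g, hg⟩ y, h1 _ _ (proj_smul h ⟨g, hg⟩ y).symm]
  rfl

theorem pullForm_eq_comp (η : RoughForm n (FlatQuotient Γ h) p) {g : E n ≃ᵃⁱ[ℝ] E n}
    (hg : g ∈ Γ) : pullForm h η = fun y => pullCLM (lin g) ((pullForm h η ∘ g) y) :=
  funext fun y => (pullForm_invariant h η hg y).symm

theorem laplacian_pullCLM_comp {α : E n → E n [⋀^Fin p]→L[ℝ] ℂ} (hα : ContDiff ℝ ∞ α)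
    (g : E n ≃ᵃⁱ[ℝ] E n) (y : E n) :
    Laplacian.laplacian (fun z => pullCLM (lin g) ((α ∘ g) z)) y =
      pullCLM (lin g) (Laplacian.laplacian α (g y)) := by
  rw [← laplacian_comp_isometry hα]
  exact ((hα.comp (contDiff_isometry g)).contDiffAt.of_le
    (WithTop.coe_le_coe.2 le_top)).laplacian_CLM_comp_left (l := pullCLM (lin g))

/-- The chart conditions constrain the pullback only on the chart targets. Every point is carried
into a target by its chart motion, and invariance of the pullback, together with that of Δ under
isometries, brings smoothness and the eigenvalue equation back to it. -/
theorem mem_eigenforms_iff (η : RoughForm n (FlatQuotient Γ h) p) (l : ℂ) :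
    η ∈ eigenforms n (FlatQuotient Γ h) p l ↔ pullForm h η ∈ invariantForms p Γ l := by
  have hmem : η ∈ eigenforms n (FlatQuotient Γ h) p l ↔
      ∀ e ∈ atlas (E n) (FlatQuotient Γ h), ContDiffOn ℝ ∞ (pullForm h η) e.target ∧
        ∀ y ∈ e.target, hodgeLaplacian (pullForm h η) y = l • pullForm h η y := by
    refine forall₂_congr fun e he => ?_
    rw [chartRep_eq_pullForm h he]
  rw [hmem]
  constructor
  · intro H
    have htarget : ∀ y, chartMotion h y • y ∈ (chartAt (E n) (proj h y)).target := fun y => by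
      rw [chartMotion_smul_self]
      exact OpenPartialHomeomorph.map_source _ (mem_chart_source _ _)
    have hsmooth : ContDiff ℝ ∞ (pullForm h η) := by
      rw [contDiff_iff_contDiffAt]
      intro y
      have h1 : ContDiffAt ℝ ∞ (pullForm h η) ((chartMotion h y).1 y) :=
        (H _ (chart_mem_atlas (E n) (proj h y))).1.contDiffAt
          ((chartAt (E n) (proj h y)).open_target.mem_nhds (htarget y))
      rw [pullForm_eq_comp h η (chartMotion h y).2]
      exact (pullCLM (lin (chartMotion h y).1)).contDiff.contDiffAt.comp y
        (h1.comp y (contDiff_isometry _).contDiffAt)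
    refine ⟨hsmooth, fun g hg y => pullForm_invariant h η hg y, fun y => ?_⟩
    have h1 := (H _ (chart_mem_atlas (E n) (proj h y))).2 _ (htarget y)
    rw [hodgeLaplacian_eq_neg_laplacian hsmooth] at h1
    have h2 := laplacian_pullCLM_comp hsmooth (chartMotion h y).1 y
    rw [← pullForm_eq_comp h η (chartMotion h y).2] at h2
    rw [h2, ← map_neg, ← coe_smul_eq, h1, ← pullForm_invariant h η (chartMotion h y).2 y]
    rfl
  · rintro ⟨hs, -, hl⟩ e he
    exact ⟨hs.contDiffOn, fun y _ => by rw [hodgeLaplacian_eq_neg_laplacian hs, hl]⟩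

theorem exists_pullForm_eq {α : E n → E n [⋀^Fin p]→L[ℝ] ℂ}
    (hα : ∀ g ∈ Γ, ∀ y, pullCLM (lin g) (α (g y)) = α y) :
    ∃ η : RoughForm n (FlatQuotient Γ h) p, pullForm h η = α := by
  -- The form is defined at one arbitrarily chosen lift of each point; invariance of α gives the
  -- same value at all other lifts.
  choose s hs using proj_surjective h
  refine ⟨fun x => pullCLM (lin (chartMotion h (s x)).1⁻¹) (α (s x)), ?_⟩
  funext y
  obtain ⟨γ, hγ⟩ := (proj_eq_iff h).1 (hs (proj h y))
  change pullCLM (lin (chartMotion h y).1)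
    (pullCLM (lin (chartMotion h (s (proj h y))).1⁻¹) (α (s (proj h y)))) = α y
  rw [← hγ, ← chartMotion_smul h γ y]
  change pullCLM (lin ((chartMotion h (γ • y)).1 * γ.1)) _ = _
  rw [pullCLM_mul, pullCLM_pullCLM_inv]
  exact hα γ.1 γ.2 y

theorem pullForm_injective : Function.Injective
    (pullForm h : RoughForm n (FlatQuotient Γ h) p → E n → E n [⋀^Fin p]→L[ℝ] ℂ) := by
  intro a b hab
  funext x
  obtain ⟨y, rfl⟩ := proj_surjective h x
  have h1 := congrArg (pullCLM (lin (chartMotion h y).1⁻¹)) (congrFun hab y)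
  exact (pullCLM_inv_pullCLM _ _).symm.trans (h1.trans (pullCLM_inv_pullCLM _ _))

theorem rank_eigenforms_eq (l : ℂ) :
    Module.rank ℂ (eigenforms n (FlatQuotient Γ h) p l) =
      Module.rank ℂ (invariantForms p Γ l) := by
  let f : eigenforms n (FlatQuotient Γ h) p l →ₗ[ℂ] invariantForms p Γ l :=
    { toFun := fun η => ⟨pullForm h η.1, (mem_eigenforms_iff h η.1 l).1 η.2⟩
      map_add' := fun _ _ => rfl
      map_smul' := fun _ _ => rfl }
  refine (LinearEquiv.ofBijective f ⟨fun a b hab => ?_, fun α => ?_⟩).rank_eq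
  · exact Subtype.ext (pullForm_injective h (congrArg Subtype.val hab))
  · obtain ⟨η, hη⟩ := exists_pullForm_eq h α.2.2.1
    exact ⟨⟨η, (mem_eigenforms_iff h η l).2 (hη ▸ α.2)⟩, Subtype.ext hη⟩

end Eigenforms

/-! ### Criteria for Bieberbach groups -/

section Criteria

variable {n : ℕ}

theorem translation_apply (b x : E n) : translation b x = b + x := rfl

theorem motion_apply (B : E n ≃ₗᵢ[ℝ] E n) (b x : E n) : motion B b x = B (b + x) := rfl

theorem linearPart_translation (b : E n) : linearPart n (translation b) = 1 :=
  LinearEquiv.ext fun _ => rfl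

theorem isometry_mul_apply (g g' : E n ≃ᵃⁱ[ℝ] E n) (x : E n) : (g * g') x = g (g' x) := rfl

theorem isometry_apply_inv_apply (g : E n ≃ᵃⁱ[ℝ] E n) (x : E n) : g (g⁻¹ x) = x :=
  g.apply_symm_apply x

theorem linearPart_motion (B : E n ≃ₗᵢ[ℝ] E n) (b : E n) :
    linearPart n (motion B b) = B.toLinearEquiv := by
  rw [motion, map_mul, linearPart_translation, mul_one]
  rfl

theorem isometry_ext_basis {g g' : E n ≃ᵃⁱ[ℝ] E n} (h0 : g 0 = g' 0)
    (h1 : ∀ i, g (EuclideanSpace.single i 1) = g' (EuclideanSpace.single i 1)) : g = g' := by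
  have h2 : ((lin g : E n →L[ℝ] E n) : E n →ₗ[ℝ] E n) = (lin g' : E n →ₗ[ℝ] E n) := by
    refine (EuclideanSpace.basisFun (Fin n) ℝ).toBasis.ext fun i => ?_
    have h3 := h1 i
    rw [apply_eq_lin_add g, apply_eq_lin_add g', h0] at h3
    simpa using h3
  ext1 x
  rw [apply_eq_lin_add g, apply_eq_lin_add g', h0]
  exact congrArg (· + _) (LinearMap.congr_fun h2 x)

theorem compactSpace_of_latticeTranslations {Γ : Subgroup (E n ≃ᵃⁱ[ℝ] E n)}
    (hΓ : latticeTranslations n ⊆ Γ) : CompactSpace (MulAction.orbitRel.Quotient Γ (E n)) := by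
  have hK : IsCompact (WithLp.toLp 2 '' (Set.univ.pi fun _ : Fin n => Icc (0 : ℝ) 1)) :=
    (isCompact_univ_pi fun _ => isCompact_Icc).image (PiLp.continuous_toLp 2 _)
  have h1 := hK.image (continuous_quot_mk (r := (MulAction.orbitRel Γ (E n)).r))
  refine ⟨h1.of_isClosed_subset isClosed_univ fun q _ => ?_⟩
  obtain ⟨x, rfl⟩ := Quot.exists_rep q
  -- Subtracting integer parts moves any point into the compact unit cube.
  refine ⟨WithLp.toLp 2 fun i => Int.fract (x i), ⟨_, fun i _ => ?_, rfl⟩, ?_⟩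
  · exact ⟨Int.fract_nonneg _, (Int.fract_lt_one _).le⟩
  · refine Quot.sound ⟨⟨_, hΓ ⟨fun i => -⌊x i⌋, rfl⟩⟩, ?_⟩
    change translation _ x = _
    ext i
    rw [translation_apply]
    simp only [PiLp.add_apply, Int.cast_neg, Int.fract]
    ring

/-- The points all of whose coordinates are integer multiples of `1 / 4`. -/
def quarterLattice (n : ℕ) : Set (E n) := {x | ∀ i, x i ∈ AddSubgroup.zmultiples (1 / 4 : ℝ)}

theorem eq_of_mem_zmultiples_of_dist_lt {r a b : ℝ} (ha : a ∈ AddSubgroup.zmultiples r)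
    (hb : b ∈ AddSubgroup.zmultiples r) (hd : |a - b| < r) : a = b := by
  obtain ⟨k, rfl⟩ := AddSubgroup.mem_zmultiples_iff.1 ha
  obtain ⟨l, rfl⟩ := AddSubgroup.mem_zmultiples_iff.1 hb
  have hr : 0 < r := (abs_nonneg _).trans_lt hd
  rw [← sub_smul, zsmul_eq_mul, abs_mul, abs_of_pos hr] at hd
  have h1 : |((k - l : ℤ) : ℝ)| < 1 := by
    by_contra! hc
    nlinarith
  have h2 : |k - l| < 1 := by exact_mod_cast h1
  rw [Int.abs_lt_one_iff, sub_eq_zero] at h2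
  rw [h2]

/-- An isometry is determined by its values at 0 and at the basis vectors. These values lie in the
quarter lattice, where distinct points are at least 1/4 apart, so finitely many evaluations isolate
each element. -/
theorem discreteTopology_of_quarterLattice {Γ : Subgroup (E n ≃ᵃⁱ[ℝ] E n)}
    (hΓ : ∀ g ∈ Γ, ∀ x ∈ quarterLattice n, g x ∈ quarterLattice n) :
    DiscreteTopology (range fun (γ : Γ) (x : E n) => γ • x) := by
  have hQ0 : (0 : E n) ∈ quarterLattice n := fun i => zero_mem _
  have hQ1 : ∀ i, EuclideanSpace.single i (1 : ℝ) ∈ quarterLattice n := fun i j => by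
    by_cases hij : j = i
    · subst hij
      exact AddSubgroup.mem_zmultiples_iff.2 ⟨4, by norm_num⟩
    · simp [hij]
  have hsep : ∀ x ∈ quarterLattice n, ∀ γ γ' : Γ, dist (γ' • x) (γ • x) < 1 / 4 →
      γ' • x = γ • x := by
    intro x hx γ γ' hd
    ext i
    refine eq_of_mem_zmultiples_of_dist_lt (hΓ _ γ'.2 x hx i) (hΓ _ γ.2 x hx i)
      (lt_of_le_of_lt ?_ hd)
    rw [dist_eq_norm]
    exact PiLp.norm_apply_le (γ' • x - γ • x) i
  rw [discreteTopology_iff_isOpen_singleton]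
  rintro ⟨_, γ, rfl⟩
  refine isOpen_induced_iff.2 ⟨{f | dist (f 0) (γ • 0) < 1 / 4} ∩
    ⋂ i : Fin n, {f | dist (f (EuclideanSpace.single i 1))
      (γ • (EuclideanSpace.single i 1 : E n)) < 1 / 4}, ?_, ?_⟩
  · refine IsOpen.inter ?_ (isOpen_iInter_of_finite fun i => ?_)
    · exact isOpen_lt ((continuous_apply _).dist continuous_const) continuous_const
    · exact isOpen_lt ((continuous_apply _).dist continuous_const) continuous_const
  · ext ⟨_, γ', rfl⟩
    constructor
    · rintro ⟨h0, h1⟩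
      have h2 : γ'.1 = γ.1 := isometry_ext_basis (hsep _ hQ0 γ γ' h0)
        fun i => hsep _ (hQ1 i) γ γ' (mem_iInter.1 h1 i)
      have h3 : γ' = γ := Subtype.ext h2
      subst h3
      rfl
    · intro hf
      have h1 : (fun x : E n => γ' • x) = fun x => γ • x := congrArg Subtype.val hf
      have h2 : ∀ x : E n, dist ((fun x : E n => γ' • x) x) (γ • x) < 1 / 4 := fun x => by
        rw [h1]
        simp
      exact ⟨h2 0, mem_iInter.2 fun i => h2 _⟩

theorem eq_zero_of_isOfFinOrder {g : E n ≃ᵃⁱ[ℝ] E n} (hg : IsOfFinOrder g) {i : Fin n} {c : ℝ}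
    (hc : ∀ x, g x i = x i + c) : c = 0 := by
  obtain ⟨k, hk, hk'⟩ := isOfFinOrder_iff_pow_eq_one.1 hg
  have h1 : ∀ (k : ℕ) (x : E n), (g ^ k) x i = x i + k * c := by
    intro k
    induction k with
    | zero => simp
    | succ k ih =>
      intro x
      rw [pow_succ, isometry_mul_apply, ih, hc]
      push_cast
      ring
  have h2 := h1 k 0
  rw [hk'] at h2
  have h3 : (k : ℝ) * c = 0 := by simpa using h2.symm
  exact (mul_eq_zero.1 h3).resolve_left (by exact_mod_cast hk.ne')

theorem eq_one_of_isOfFinOrder {g : E n ≃ᵃⁱ[ℝ] E n} (hg : IsOfFinOrder g)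
    (h1 : linearPart n g = 1) : g = 1 := by
  have h2 : ∀ x, g x = x + g 0 := fun x => by
    have := apply_eq_lin_add g x
    rwa [lin_apply, h1] at this
  have h3 : g 0 = 0 := by
    ext i
    refine eq_zero_of_isOfFinOrder hg (i := i) fun x => ?_
    rw [h2]
    rfl
  ext1 x
  rw [h2, h3, add_zero]
  rfl

end Criteria

/-! ### The generators of the two groups -/

/-- The generator `B₁ L_{e₁/2}` of `Γ`. -/
def genOne : E 4 ≃ᵃⁱ[ℝ] E 4 := motion (matrixIsometry _ mem_orthogonal_one) !₂[1 / 2, 0, 0, 0]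

/-- The generator `B₂ L_{e₄/2}` of `Γ`. -/
def genTwo : E 4 ≃ᵃⁱ[ℝ] E 4 := motion (matrixIsometry _ mem_orthogonal_two) !₂[0, 0, 0, 1 / 2]

/-- The generator `B' L_{e₄/4}` of `Γ'`. -/
def genThree : E 4 ≃ᵃⁱ[ℝ] E 4 := motion (matrixIsometry _ mem_orthogonal_three) !₂[0, 0, 0, 1 / 4]

theorem genOne_apply (x : E 4) : genOne x = !₂[x 0 + 1 / 2, x 1, -x 2, -x 3] := by
  rw [genOne, motion_apply]
  ext i
  fin_cases i <;>
    simp [matrixIsometry, dotProduct, Fin.sum_univ_four, add_comm]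

theorem genTwo_apply (x : E 4) : genTwo x = !₂[x 0, -x 1, -x 2, x 3 + 1 / 2] := by
  rw [genTwo, motion_apply]
  ext i
  fin_cases i <;>
    simp [matrixIsometry, dotProduct, Fin.sum_univ_four, add_comm]

theorem genThree_apply (x : E 4) : genThree x = !₂[x 1, -x 0, -x 2, x 3 + 1 / 4] := by
  rw [genThree, motion_apply]
  ext i
  fin_cases i <;>
    simp [matrixIsometry, dotProduct, Fin.sum_univ_four, add_comm]

theorem linearPart_genOne_apply (x : E 4) : linearPart 4 genOne x = !₂[x 0, x 1, -x 2, -x 3] := by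
  rw [genOne, linearPart_motion]
  ext i
  fin_cases i <;>
    simp [matrixIsometry, dotProduct, Fin.sum_univ_four]

theorem linearPart_genTwo_apply (x : E 4) : linearPart 4 genTwo x = !₂[x 0, -x 1, -x 2, x 3] := by
  rw [genTwo, linearPart_motion]
  ext i
  fin_cases i <;>
    simp [matrixIsometry, dotProduct, Fin.sum_univ_four]

theorem linearPart_genThree_apply (x : E 4) :
    linearPart 4 genThree x = !₂[x 1, -x 0, -x 2, x 3] := by
  rw [genThree, linearPart_motion]
  ext i
  fin_cases i <;>
    simp [matrixIsometry, dotProduct, Fin.sum_univ_four]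

theorem groupOne_eq : groupOne = Subgroup.closure ({genOne, genTwo} ∪ latticeTranslations 4) := rfl

theorem groupTwo_eq : groupTwo = Subgroup.closure ({genThree} ∪ latticeTranslations 4) := rfl

theorem lattice_subset_groupOne : latticeTranslations 4 ⊆ groupOne :=
  subset_union_right.trans Subgroup.subset_closure

theorem lattice_subset_groupTwo : latticeTranslations 4 ⊆ groupTwo :=
  subset_union_right.trans Subgroup.subset_closure

theorem genOne_mem : genOne ∈ groupOne := Subgroup.subset_closure (by simp [genOne])

theorem genTwo_mem : genTwo ∈ groupOne := Subgroup.subset_closure (by simp [genTwo])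

theorem genThree_mem : genThree ∈ groupTwo := Subgroup.subset_closure (by simp [genThree])

@[elab_as_elim]
theorem groupOne_induction {P : (E 4 ≃ᵃⁱ[ℝ] E 4) → Prop} (h1 : P genOne) (h2 : P genTwo)
    (ht : ∀ v : Fin 4 → ℤ, P (translation (WithLp.toLp 2 fun i => (v i : ℝ))))
    (hm : ∀ g g', P g → P g' → P (g * g')) (hi : ∀ g, P g → P g⁻¹) {g : E 4 ≃ᵃⁱ[ℝ] E 4}
    (hg : g ∈ groupOne) : P g := by
  rw [groupOne_eq] at hg
  induction hg using Subgroup.closure_induction with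
  | mem x hx =>
    rcases hx with (rfl | rfl) | ⟨v, rfl⟩
    exacts [h1, h2, ht v]
  | one => simpa using hm _ _ h1 (hi _ h1)
  | mul x y _ _ hx hy => exact hm _ _ hx hy
  | inv x _ hx => exact hi _ hx

@[elab_as_elim]
theorem groupTwo_induction {P : (E 4 ≃ᵃⁱ[ℝ] E 4) → Prop} (h1 : P genThree)
    (ht : ∀ v : Fin 4 → ℤ, P (translation (WithLp.toLp 2 fun i => (v i : ℝ))))
    (hm : ∀ g g', P g → P g' → P (g * g')) (hi : ∀ g, P g → P g⁻¹) {g : E 4 ≃ᵃⁱ[ℝ] E 4}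
    (hg : g ∈ groupTwo) : P g := by
  rw [groupTwo_eq] at hg
  induction hg using Subgroup.closure_induction with
  | mem x hx =>
    rcases hx with rfl | ⟨v, rfl⟩
    exacts [h1, ht v]
  | one => simpa using hm _ _ h1 (hi _ h1)
  | mul x y _ _ hx hy => exact hm _ _ hx hy
  | inv x _ hx => exact hi _ hx

/-! #### Discreteness -/

theorem mem_quarterLattice_translation (v : Fin 4 → ℤ) (x : E 4) :
    translation (WithLp.toLp 2 fun i => (v i : ℝ)) x ∈ quarterLattice 4 ↔
      x ∈ quarterLattice 4 := by
  refine forall_congr' fun i => ?_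
  rw [translation_apply, PiLp.add_apply]
  exact add_mem_cancel_left (AddSubgroup.mem_zmultiples_iff.2 ⟨4 * v i, by
    simp only [zsmul_eq_mul]; push_cast; ring⟩)

theorem half_mem_zmultiples : (1 / 2 : ℝ) ∈ AddSubgroup.zmultiples (1 / 4 : ℝ) :=
  AddSubgroup.mem_zmultiples_iff.2 ⟨2, by norm_num⟩

theorem mem_quarterLattice_genOne (x : E 4) :
    genOne x ∈ quarterLattice 4 ↔ x ∈ quarterLattice 4 := by
  rw [genOne_apply]
  simp only [quarterLattice, mem_ofPred_eq, Fin.forall_fin_succ]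
  simp [add_mem_cancel_right, half_mem_zmultiples, -one_div]

theorem mem_quarterLattice_genTwo (x : E 4) :
    genTwo x ∈ quarterLattice 4 ↔ x ∈ quarterLattice 4 := by
  rw [genTwo_apply]
  simp only [quarterLattice, mem_ofPred_eq, Fin.forall_fin_succ]
  simp [add_mem_cancel_right, half_mem_zmultiples, -one_div]

theorem mem_quarterLattice_genThree (x : E 4) :
    genThree x ∈ quarterLattice 4 ↔ x ∈ quarterLattice 4 := by
  rw [genThree_apply]
  simp only [quarterLattice, mem_ofPred_eq, Fin.forall_fin_succ]
  simp [add_mem_cancel_right, -one_div]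
  tauto

/-- The equivalence, unlike the bare implication, passes to inverses and so suits the induction over
the generators. -/
theorem groupOne_quarterLattice {g : E 4 ≃ᵃⁱ[ℝ] E 4} (hg : g ∈ groupOne) :
    ∀ x, g x ∈ quarterLattice 4 ↔ x ∈ quarterLattice 4 := by
  refine groupOne_induction (P := fun g => ∀ x, g x ∈ quarterLattice 4 ↔ x ∈ quarterLattice 4)
    mem_quarterLattice_genOne mem_quarterLattice_genTwo mem_quarterLattice_translation
    (fun g g' h h' x => (h _).trans (h' _)) (fun g h x => ?_) hg
  rw [← h (g⁻¹ x), isometry_apply_inv_apply]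

theorem groupTwo_quarterLattice {g : E 4 ≃ᵃⁱ[ℝ] E 4} (hg : g ∈ groupTwo) :
    ∀ x, g x ∈ quarterLattice 4 ↔ x ∈ quarterLattice 4 := by
  refine groupTwo_induction (P := fun g => ∀ x, g x ∈ quarterLattice 4 ↔ x ∈ quarterLattice 4)
    mem_quarterLattice_genThree mem_quarterLattice_translation
    (fun g g' h h' x => (h _).trans (h' _)) (fun g h x => ?_) hg
  rw [← h (g⁻¹ x), isometry_apply_inv_apply]

/-! #### Relations between the rotational parts -/

theorem linearPart_genOne_sq : linearPart 4 genOne * linearPart 4 genOne = 1 := by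
  ext x i
  rw [LinearEquiv.mul_apply, linearPart_genOne_apply, linearPart_genOne_apply]
  fin_cases i <;> simp

theorem linearPart_genTwo_sq : linearPart 4 genTwo * linearPart 4 genTwo = 1 := by
  ext x i
  rw [LinearEquiv.mul_apply, linearPart_genTwo_apply, linearPart_genTwo_apply]
  fin_cases i <;> simp

theorem linearPart_genOne_genTwo_apply (x : E 4) :
    (linearPart 4 genOne * linearPart 4 genTwo) x = !₂[x 0, -x 1, x 2, -x 3] := by
  ext i
  rw [LinearEquiv.mul_apply, linearPart_genOne_apply, linearPart_genTwo_apply]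
  fin_cases i <;> simp

theorem linearPart_commute : Commute (linearPart 4 genOne) (linearPart 4 genTwo) := by
  ext x i
  rw [linearPart_genOne_genTwo_apply, LinearEquiv.mul_apply, linearPart_genTwo_apply,
    linearPart_genOne_apply]
  fin_cases i <;> simp

theorem linearPart_genThree_pow_two_apply (x : E 4) :
    (linearPart 4 genThree ^ 2) x = !₂[-x 0, -x 1, x 2, x 3] := by
  ext i
  rw [sq, LinearEquiv.mul_apply, linearPart_genThree_apply, linearPart_genThree_apply]
  fin_cases i <;> simp

theorem linearPart_genThree_pow_three_apply (x : E 4) :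
    (linearPart 4 genThree ^ 3) x = !₂[-x 1, x 0, -x 2, x 3] := by
  ext i
  rw [pow_succ, LinearEquiv.mul_apply, linearPart_genThree_apply,
    linearPart_genThree_pow_two_apply]
  fin_cases i <;> simp

theorem linearPart_genThree_pow_four : linearPart 4 genThree ^ 4 = 1 := by
  ext x i
  rw [pow_succ, LinearEquiv.mul_apply, linearPart_genThree_apply,
    linearPart_genThree_pow_three_apply]
  fin_cases i <;> simp

/-! #### Torsion-freeness -/

/-- The exponents of the rotational part are recorded by shifts. Coordinate 0 is fixed by B₁ and B₂,
so it sees m; coordinate 3 is reversed by B₁ only, so it sees k once m = 0. An element of finite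
order thus has m = k = 0. -/
theorem groupOne_structure {g : E 4 ≃ᵃⁱ[ℝ] E 4} (hg : g ∈ groupOne) :
    ∃ m k : ℤ, linearPart 4 g = linearPart 4 genOne ^ m * linearPart 4 genTwo ^ k ∧
      (∀ x, g x 0 = x 0 + m / 2) ∧
      ∀ x, g x 3 = ((Int.negOnePow m : ℤ) : ℝ) * x 3 + k / 2 := by
  have hb : ∀ k : ℤ, linearPart 4 genTwo ^ (2 * k) = 1 := fun k => by
    rw [zpow_mul, zpow_two, linearPart_genTwo_sq, one_zpow]
  have ha : ∀ k : ℤ, linearPart 4 genOne ^ (2 * k) = 1 := fun k => by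
    rw [zpow_mul, zpow_two, linearPart_genOne_sq, one_zpow]
  -- Exponents of B₂ matter only modulo 2, so the sign that composition puts on k is harmless.
  have hu : ∀ (ε : ℤˣ) (k : ℤ), linearPart 4 genTwo ^ ((ε : ℤ) * k) = linearPart 4 genTwo ^ k := by
    intro ε k
    rcases Int.units_eq_one_or ε with rfl | rfl
    · simp
    · rw [Units.val_neg, Units.val_one, neg_one_mul, ← mul_one (_ ^ (-k)), ← hb k, ← zpow_add]
      congr 1
      ring
  refine groupOne_induction ?_ ?_ ?_ ?_ ?_ hg
  · refine ⟨1, 0, by simp, fun x => by simp [genOne_apply], fun x => by simp [genOne_apply]⟩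
  · refine ⟨0, 1, by simp, fun x => by simp [genTwo_apply], fun x => by simp [genTwo_apply]⟩
  · intro v
    -- Integer translations correspond to even exponents, at which the rotational parts are trivial.
    refine ⟨2 * v 0, 2 * v 3, ?_, fun x => ?_, fun x => ?_⟩
    · rw [linearPart_translation, ha, hb, one_mul]
    · simp [translation_apply, add_comm]
    · rw [Int.negOnePow_two_mul]
      simp [translation_apply, add_comm]
  · rintro g g' ⟨m, k, h1, h2, h3⟩ ⟨m', k', h1', h2', h3'⟩
    refine ⟨m + m', (Int.negOnePow m : ℤ) * k' + k, ?_, fun x => ?_, fun x => ?_⟩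
    · rw [map_mul, h1, h1', zpow_add _ (_ * _), hu, zpow_add, mul_assoc, mul_assoc,
        (linearPart_commute.zpow_zpow m' k').eq, ← mul_assoc (_ ^ k), ← mul_assoc (_ ^ m'),
        (linearPart_commute.zpow_zpow m' k').eq, mul_assoc (_ ^ k'),
        (linearPart_commute.zpow_zpow m' k).eq, ← mul_assoc (_ ^ k'), ← zpow_add, ← zpow_add,
        add_comm k]
    · rw [isometry_mul_apply, h2, h2']
      push_cast
      ring
    · rw [isometry_mul_apply, h3, h3', Int.negOnePow_add]
      push_cast
      ring
  · rintro g ⟨m, k, h1, h2, h3⟩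
    have hsq : (((Int.negOnePow m : ℤ) : ℝ)) * ((Int.negOnePow m : ℤ) : ℝ) = 1 := by
      rw [← Int.cast_mul, ← Units.val_mul, Int.units_mul_self]
      simp
    refine ⟨-m, (Int.negOnePow m : ℤ) * -k, ?_, fun x => ?_, fun x => ?_⟩
    · rw [map_inv, h1, mul_inv_rev, hu, zpow_neg, zpow_neg]
      exact ((linearPart_commute.zpow_zpow m k).inv_inv).eq.symm
    · have := h2 (g⁻¹ x)
      rw [isometry_apply_inv_apply] at this
      rw [this]
      push_cast
      ring
    · have := h3 (g⁻¹ x)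
      rw [isometry_apply_inv_apply] at this
      rw [this, Int.negOnePow_neg]
      push_cast
      linear_combination (-(g⁻¹ x 3)) * hsq

/-- B' fixes the last coordinate, so the shift there records the exponent m; integer shifts are
multiples of 4 in m, consistent with B'⁴ = 1. -/
theorem groupTwo_structure {g : E 4 ≃ᵃⁱ[ℝ] E 4} (hg : g ∈ groupTwo) :
    ∃ m : ℤ, linearPart 4 g = linearPart 4 genThree ^ m ∧ ∀ x, g x 3 = x 3 + m / 4 := by
  refine groupTwo_induction ?_ ?_ ?_ ?_ hg
  · exact ⟨1, by simp, fun x => by simp [genThree_apply]⟩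
  · intro v
    refine ⟨4 * v 3, ?_, fun x => ?_⟩
    · rw [linearPart_translation, zpow_mul]
      have : linearPart 4 genThree ^ (4 : ℤ) = 1 := by exact_mod_cast linearPart_genThree_pow_four
      rw [this, one_zpow]
    · simp [translation_apply, add_comm]
  · rintro g g' ⟨m, h1, h2⟩ ⟨m', h1', h2'⟩
    refine ⟨m + m', by rw [map_mul, h1, h1', zpow_add], fun x => ?_⟩
    rw [isometry_mul_apply, h2, h2']
    push_cast
    ring
  · rintro g ⟨m, h1, h2⟩
    refine ⟨-m, by rw [map_inv, h1, zpow_neg], fun x => ?_⟩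
    have := h2 (g⁻¹ x)
    rw [isometry_apply_inv_apply] at this
    rw [this]
    push_cast
    ring

theorem isBieberbach_groupOne : IsBieberbach groupOne where
  discrete := discreteTopology_of_quarterLattice fun _ hg x hx =>
    (groupOne_quarterLattice hg x).2 hx
  cocompact := compactSpace_of_latticeTranslations lattice_subset_groupOne
  torsionFree γ hγ := by
    have hγ' : IsOfFinOrder γ.1 := Submonoid.isOfFinOrder_coe.2 hγ
    obtain ⟨m, k, h1, h2, h3⟩ := groupOne_structure γ.2
    have hm : m = 0 := by
      have := eq_zero_of_isOfFinOrder hγ' h2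
      field_simp at this
      exact_mod_cast this
    subst hm
    have hk : k = 0 := by
      have := eq_zero_of_isOfFinOrder hγ' (i := 3) (c := k / 2) fun x => by simpa using h3 x
      field_simp at this
      exact_mod_cast this
    subst hk
    exact Subtype.ext (eq_one_of_isOfFinOrder hγ' (by simpa using h1))

theorem isBieberbach_groupTwo : IsBieberbach groupTwo where
  discrete := discreteTopology_of_quarterLattice fun _ hg x hx =>
    (groupTwo_quarterLattice hg x).2 hx
  cocompact := compactSpace_of_latticeTranslations lattice_subset_groupTwo
  torsionFree γ hγ := by
    have hγ' : IsOfFinOrder γ.1 := Submonoid.isOfFinOrder_coe.2 hγ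
    obtain ⟨m, h1, h2⟩ := groupTwo_structure γ.2
    have hm : m = 0 := by
      have := eq_zero_of_isOfFinOrder hγ' h2
      field_simp at this
      exact_mod_cast this
    subst hm
    exact Subtype.ext (eq_one_of_isOfFinOrder hγ' (by simpa using h1))

/-! #### Point groups -/

theorem mem_pointGroup_groupOne {B : E 4 ≃ₗ[ℝ] E 4} (hB : B ∈ pointGroup groupOne) :
    B = 1 ∨ B = linearPart 4 genOne ∨ B = linearPart 4 genTwo ∨
      B = linearPart 4 genOne * linearPart 4 genTwo := by
  obtain ⟨g, hg, rfl⟩ := hB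
  obtain ⟨m, k, h1, -, -⟩ := groupOne_structure hg
  have ha : linearPart 4 genOne ^ (2 : ℤ) = 1 := by rw [zpow_two, linearPart_genOne_sq]
  have hb : linearPart 4 genTwo ^ (2 : ℤ) = 1 := by rw [zpow_two, linearPart_genTwo_sq]
  rw [h1]
  obtain ⟨m, rfl | rfl⟩ := m.even_or_odd' <;> obtain ⟨k, rfl | rfl⟩ := k.even_or_odd' <;>
    simp [zpow_add, zpow_mul, ha, hb]

theorem mem_pointGroup_groupTwo {B : E 4 ≃ₗ[ℝ] E 4} (hB : B ∈ pointGroup groupTwo) :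
    B = 1 ∨ B = linearPart 4 genThree ∨ B = linearPart 4 genThree ^ 2 ∨
      B = linearPart 4 genThree ^ 3 := by
  obtain ⟨g, hg, rfl⟩ := hB
  obtain ⟨m, h1, -⟩ := groupTwo_structure hg
  have ha : linearPart 4 genThree ^ (4 : ℤ) = 1 := by exact_mod_cast linearPart_genThree_pow_four
  have h4 : linearPart 4 genThree ^ m = linearPart 4 genThree ^ (m % 4) := by
    conv_lhs => rw [← Int.emod_add_mul_ediv m 4, zpow_add, zpow_mul, ha, one_zpow, mul_one]
  rw [h1, h4]
  have h5 := Int.emod_nonneg m (show (4 : ℤ) ≠ 0 by norm_num)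
  have h6 := Int.emod_lt_of_pos m (show (0 : ℤ) < 4 by norm_num)
  generalize m % 4 = r at h5 h6
  interval_cases r
  · simp
  · simp
  · right; right; left; exact_mod_cast rfl
  · right; right; right; exact_mod_cast rfl

theorem linearPart_genOne_ne_one : linearPart 4 genOne ≠ 1 := fun h => by
  have := congrArg (fun v : E 4 => v 2) (LinearEquiv.congr_fun h !₂[0, 0, 1, 0])
  rw [linearPart_genOne_apply] at this
  simp at this
  norm_num at this

theorem linearPart_genTwo_ne_one : linearPart 4 genTwo ≠ 1 := fun h => by
  have := congrArg (fun v : E 4 => v 2) (LinearEquiv.congr_fun h !₂[0, 0, 1, 0])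
  rw [linearPart_genTwo_apply] at this
  simp at this
  norm_num at this

theorem linearPart_genOne_ne_genTwo : linearPart 4 genOne ≠ linearPart 4 genTwo := fun h => by
  have := congrArg (fun v : E 4 => v 1) (LinearEquiv.congr_fun h !₂[0, 1, 0, 0])
  rw [linearPart_genOne_apply, linearPart_genTwo_apply] at this
  simp at this
  norm_num at this

theorem linearPart_genThree_sq_ne_one : linearPart 4 genThree ^ 2 ≠ 1 := fun h => by
  have := congrArg (fun v : E 4 => v 0) (LinearEquiv.congr_fun h !₂[1, 0, 0, 0])
  rw [linearPart_genThree_pow_two_apply] at this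
  simp at this
  norm_num at this

theorem isKleinFour_pointGroup_groupOne : IsKleinFour (pointGroup groupOne) := by
  set a := linearPart 4 genOne with ha
  set b := linearPart 4 genTwo with hb
  have haa : a * a = 1 := linearPart_genOne_sq
  have hbb : b * b = 1 := linearPart_genTwo_sq
  have hab : a * b = b * a := linearPart_commute
  have ha1 : a ≠ 1 := linearPart_genOne_ne_one
  have hb1 : b ≠ 1 := linearPart_genTwo_ne_one
  have hne : a ≠ b := linearPart_genOne_ne_genTwo
  have ham : a ∈ pointGroup groupOne := ⟨_, genOne_mem, rfl⟩
  have hbm : b ∈ pointGroup groupOne := ⟨_, genTwo_mem, rfl⟩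
  have hset : (pointGroup groupOne : Set (E 4 ≃ₗ[ℝ] E 4)) = {1, a, b, a * b} := by
    ext B
    constructor
    · exact mem_pointGroup_groupOne
    · rintro (rfl | rfl | rfl | rfl)
      exacts [one_mem _, ham, hbm, mul_mem ham hbm]
  constructor
  · have h1 : Nat.card (pointGroup groupOne) = ({1, a, b, a * b} : Set (E 4 ≃ₗ[ℝ] E 4)).ncard := by
      rw [← hset]
      rfl
    have h3 : b ≠ a * b := fun h => ha1 (by simpa using h)
    have h4 : a ≠ a * b := fun h => hb1 (by simpa using h)
    have h5 : 1 ≠ a * b := fun h => hne (by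
      rw [← mul_one a, h, ← mul_assoc, haa, one_mul])
    rw [h1, Set.ncard_insert_of_notMem (by simp [ha1.symm, hb1.symm, h5]),
      Set.ncard_insert_of_notMem (by simp [hne, h4]), Set.ncard_pair h3]
  · have : Nontrivial (pointGroup groupOne) :=
      ⟨⟨⟨a, ham⟩, 1, fun h => ha1 (congrArg Subtype.val h)⟩⟩
    rw [Monoid.exponent_eq_prime_iff Nat.prime_two]
    rintro ⟨B, hB⟩ hB1
    refine orderOf_eq_prime (Subtype.ext ?_) hB1
    change B ^ 2 = 1
    rw [sq]
    rcases mem_pointGroup_groupOne hB with rfl | rfl | rfl | rfl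
    · rw [mul_one]
    · exact haa
    · exact hbb
    · rw [mul_assoc, ← mul_assoc b, ← hab, mul_assoc, hbb, mul_one, haa]

theorem pointGroup_groupTwo_eq : pointGroup groupTwo = Subgroup.zpowers (linearPart 4 genThree) := by
  apply le_antisymm
  · intro B hB
    rcases mem_pointGroup_groupTwo hB with rfl | rfl | rfl | rfl
    · exact one_mem _
    · exact Subgroup.mem_zpowers _
    · exact pow_mem (Subgroup.mem_zpowers _) _
    · exact pow_mem (Subgroup.mem_zpowers _) _
  · rw [Subgroup.zpowers_le]
    exact ⟨_, genThree_mem, rfl⟩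

theorem nonempty_pointGroup_groupOne_mulEquiv :
    Nonempty (pointGroup groupOne ≃* Multiplicative (ZMod 2 × ZMod 2)) :=
  have := isKleinFour_pointGroup_groupOne
  IsKleinFour.nonempty_mulEquiv

theorem nonempty_pointGroup_groupTwo_mulEquiv :
    Nonempty (pointGroup groupTwo ≃* Multiplicative (ZMod 4)) := by
  rw [pointGroup_groupTwo_eq]
  have h1 : orderOf (linearPart 4 genThree) = 2 ^ (1 + 1) :=
    orderOf_eq_prime_pow linearPart_genThree_sq_ne_one linearPart_genThree_pow_four
  have h2 : Nat.card (Subgroup.zpowers (linearPart 4 genThree)) =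
      Nat.card (Multiplicative (ZMod 4)) := by
    rw [Nat.card_zpowers, h1]
    simp [Nat.card_eq_fintype_card]
  exact ⟨mulEquivOfCyclicCardEq h2⟩

/-! #### Traces on exterior powers -/

theorem exteriorPower_map_neg {V : Type} [AddCommGroup V] [Module ℝ V] (p : ℕ) (f : V →ₗ[ℝ] V) :
    exteriorPower.map p (-f) = (-1 : ℝ) ^ p • exteriorPower.map p f := by
  refine exteriorPower.linearMap_ext (AlternatingMap.ext fun v => ?_)
  have h := (exteriorPower.ιMulti ℝ p (M := V)).toMultilinearMap.map_smul_univ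
    (fun _ => (-1 : ℝ)) (fun i => f (v i))
  simpa [Function.comp_def] using h

/-- Conjugate maps have equal traces on Λᵖ, while passing from f to -f multiplies the trace by (-1)ᵖ
= -1. -/
theorem extTrace_eq_zero_of_conj_eq_neg {V : Type} [AddCommGroup V] [Module ℝ V]
    [Module.Finite ℝ V] {p : ℕ}
    (hp : Odd p) (f : V →ₗ[ℝ] V) (T : V ≃ₗ[ℝ] V) (h : ∀ v, T (f (T.symm v)) = -f v) :
    extTrace p f = 0 := by
  have h1 : -f = T.toLinearMap ∘ₗ f ∘ₗ T.symm.toLinearMap := by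
    ext v
    exact (h v).symm
  have h2 : extTrace p (-f) = extTrace p f := by
    rw [extTrace, extTrace, h1, exteriorPower.map_comp, LinearMap.trace_comp_comm',
      ← exteriorPower.map_comp, LinearMap.comp_assoc, LinearEquiv.symm_comp, LinearMap.comp_id]
  have h3 : extTrace p (-f) = -extTrace p f := by
    rw [extTrace, exteriorPower_map_neg, map_smul, hp.neg_one_pow, neg_one_smul, extTrace]
  linarith

/-- The permutation of the coordinates of `ℝ⁴` by an involution. -/
def permCoord (τ : Fin 4 → Fin 4) (hτ : ∀ i, τ (τ i) = i) : E 4 ≃ₗ[ℝ] E 4 :=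
  LinearEquiv.ofInvolutive
    { toFun := fun x => WithLp.toLp 2 fun i => x (τ i)
      map_add' := fun _ _ => rfl
      map_smul' := fun _ _ => rfl }
    fun x => by ext i; exact congrArg x (hτ i)

theorem permCoord_apply (τ : Fin 4 → Fin 4) (hτ : ∀ i, τ (τ i) = i) (x : E 4) (i : Fin 4) :
    permCoord τ hτ x i = x (τ i) := rfl

theorem permCoord_symm_apply (τ : Fin 4 → Fin 4) (hτ : ∀ i, τ (τ i) = i) (x : E 4)
    (i : Fin 4) : (permCoord τ hτ).symm x i = x (τ i) := rfl

/-- Each nontrivial element is diagonal with two entries 1 and two entries -1; the permutation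
exchanges the two kinds of coordinates. -/
theorem extTrace_pointGroup_groupOne {p : ℕ} (hp : Odd p) {B : E 4 ≃ₗ[ℝ] E 4}
    (hB : B ∈ pointGroup groupOne) (hB1 : B ≠ 1) : extTrace p B.toLinearMap = 0 := by
  rcases mem_pointGroup_groupOne hB with rfl | rfl | rfl | rfl
  · exact absurd rfl hB1
  · refine extTrace_eq_zero_of_conj_eq_neg hp _
      (permCoord ![2, 3, 0, 1] (by decide)) fun v => ?_
    ext i
    simp only [LinearEquiv.coe_coe, linearPart_genOne_apply, permCoord_apply]
    fin_cases i <;> simp [permCoord_symm_apply]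
  · refine extTrace_eq_zero_of_conj_eq_neg hp _
      (permCoord ![1, 0, 3, 2] (by decide)) fun v => ?_
    ext i
    simp only [LinearEquiv.coe_coe, linearPart_genTwo_apply, permCoord_apply]
    fin_cases i <;> simp [permCoord_symm_apply]
  · refine extTrace_eq_zero_of_conj_eq_neg hp _
      (permCoord ![1, 0, 3, 2] (by decide)) fun v => ?_
    ext i
    simp only [LinearEquiv.coe_coe, linearPart_genOne_genTwo_apply, permCoord_apply]
    fin_cases i <;> simp [permCoord_symm_apply]

/-- For B' and its cube, swapping the first two coordinates turns the rotation block into its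
negative, and swapping the last two does the same to diag(-1, 1). -/
theorem extTrace_pointGroup_groupTwo {p : ℕ} (hp : Odd p) {B : E 4 ≃ₗ[ℝ] E 4}
    (hB : B ∈ pointGroup groupTwo) (hB1 : B ≠ 1) : extTrace p B.toLinearMap = 0 := by
  rcases mem_pointGroup_groupTwo hB with rfl | rfl | rfl | rfl
  · exact absurd rfl hB1
  · refine extTrace_eq_zero_of_conj_eq_neg hp _
      (permCoord ![1, 0, 3, 2] (by decide)) fun v => ?_
    ext i
    simp only [LinearEquiv.coe_coe, linearPart_genThree_apply, permCoord_apply]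
    fin_cases i <;> simp [permCoord_symm_apply]
  · refine extTrace_eq_zero_of_conj_eq_neg hp _
      (permCoord ![2, 3, 0, 1] (by decide)) fun v => ?_
    ext i
    simp only [LinearEquiv.coe_coe, linearPart_genThree_pow_two_apply, permCoord_apply]
    fin_cases i <;> simp [permCoord_symm_apply]
  · refine extTrace_eq_zero_of_conj_eq_neg hp _
      (permCoord ![1, 0, 3, 2] (by decide)) fun v => ?_
    ext i
    simp only [LinearEquiv.coe_coe, linearPart_genThree_pow_three_apply, permCoord_apply]
    fin_cases i <;> simp [permCoord_symm_apply]

/-! ### Invariant forms and periodic functions -/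

/-- The smooth `ℤ⁴`-periodic functions `f` on `ℝ⁴` with `-Δf = l f`. -/
def periodicEigenfunctions (l : ℂ) : Submodule ℂ (E 4 → ℂ) where
  carrier := {f | ContDiff ℝ ∞ f ∧ (∀ g ∈ latticeTranslations 4, ∀ y, f (g y) = f y) ∧
    ∀ y, -Laplacian.laplacian f y = l • f y}
  zero_mem' := by
    refine ⟨contDiff_const, fun g _ y => rfl, fun y => ?_⟩
    rw [show (0 : E 4 → ℂ) = fun _ => 0 from rfl]
    simp
  add_mem' := by
    rintro a b ⟨ha, ha', ha''⟩ ⟨hb, hb', hb''⟩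
    refine ⟨ha.add hb, fun g hg y => ?_, fun y => ?_⟩
    · rw [Pi.add_apply, ha' g hg, hb' g hg, Pi.add_apply]
    · rw [(ha.contDiffAt.of_le (WithTop.coe_le_coe.2 le_top)).laplacian_add
        (hb.contDiffAt.of_le (WithTop.coe_le_coe.2 le_top)), neg_add, ha'', hb'', Pi.add_apply,
        smul_add]
  smul_mem' := by
    rintro c a ⟨ha, ha', ha''⟩
    refine ⟨ha.const_smul c, fun g hg y => ?_, fun y => ?_⟩
    · rw [Pi.smul_apply, Pi.smul_apply, ha' g hg y]
    · rw [laplacian_smul_complex c ha, Pi.smul_apply, ← smul_neg, ha'', smul_comm]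

/-! ### Action of the generators on periodic eigenfunctions. -/

variable {l : ℂ} {p : ℕ}

theorem periodicEigenfunctions_periodic {f : E 4 → ℂ} (hf : f ∈ periodicEigenfunctions l)
    {x y : E 4} (v : Fin 4 → ℤ) (hxy : ∀ i, x i = v i + y i) : f x = f y := by
  rw [← hf.2.1 _ ⟨v, rfl⟩ y]
  congr 1
  ext i
  rw [hxy, translation_apply]
  rfl

/-- A rotational part preserving ℤ⁴ turns a lattice translation before `g` into one after `g`, and
isometries commute with Δ. -/
theorem comp_mem_periodicEigenfunctions {g : E 4 ≃ᵃⁱ[ℝ] E 4}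
    (hg : ∀ v : Fin 4 → ℤ, ∃ w : Fin 4 → ℤ, ∀ i,
      linearPart 4 g (WithLp.toLp 2 fun i => (v i : ℝ)) i = w i) {f : E 4 → ℂ}
    (hf : f ∈ periodicEigenfunctions l) : (fun y => f (g y)) ∈ periodicEigenfunctions l := by
  refine ⟨hf.1.comp (contDiff_isometry g), ?_, fun y => ?_⟩
  · rintro _ ⟨v, rfl⟩ y
    obtain ⟨w, hw⟩ := hg v
    refine periodicEigenfunctions_periodic hf w fun i => ?_
    rw [translation_apply, apply_eq_lin_add, map_add, add_assoc, ← apply_eq_lin_add,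
      PiLp.add_apply, ← hw]
    rfl
  · rw [show (fun y => f (g y)) = f ∘ g from rfl, laplacian_comp_isometry hf.1]
    exact hf.2.2 _

theorem comp_genOne_mem {f : E 4 → ℂ} (hf : f ∈ periodicEigenfunctions l) :
    (fun y => f (genOne y)) ∈ periodicEigenfunctions l := by
  refine comp_mem_periodicEigenfunctions (fun v => ⟨![v 0, v 1, -v 2, -v 3], fun i => ?_⟩) hf
  rw [linearPart_genOne_apply]
  fin_cases i <;> simp

theorem comp_genTwo_mem {f : E 4 → ℂ} (hf : f ∈ periodicEigenfunctions l) :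
    (fun y => f (genTwo y)) ∈ periodicEigenfunctions l := by
  refine comp_mem_periodicEigenfunctions (fun v => ⟨![v 0, -v 1, -v 2, v 3], fun i => ?_⟩) hf
  rw [linearPart_genTwo_apply]
  fin_cases i <;> simp

theorem comp_genThree_mem {f : E 4 → ℂ} (hf : f ∈ periodicEigenfunctions l) :
    (fun y => f (genThree y)) ∈ periodicEigenfunctions l := by
  refine comp_mem_periodicEigenfunctions (fun v => ⟨![v 1, -v 0, -v 2, v 3], fun i => ?_⟩) hf
  rw [linearPart_genThree_apply]
  fin_cases i <;> simp

/-- This and the next three lemmas say that the generators satisfy the relations of the point group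
modulo ℤ⁴, so that the point group acts on periodic functions. -/
theorem apply_genOne_genOne {f : E 4 → ℂ} (hf : f ∈ periodicEigenfunctions l) (y : E 4) :
    f (genOne (genOne y)) = f y := by
  refine periodicEigenfunctions_periodic hf ![1, 0, 0, 0] fun i => ?_
  rw [genOne_apply, genOne_apply]
  fin_cases i <;> simp
  ring

theorem apply_genTwo_genTwo {f : E 4 → ℂ} (hf : f ∈ periodicEigenfunctions l) (y : E 4) :
    f (genTwo (genTwo y)) = f y := by
  refine periodicEigenfunctions_periodic hf ![0, 0, 0, 1] fun i => ?_
  rw [genTwo_apply, genTwo_apply]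
  fin_cases i <;> simp
  ring

theorem apply_genTwo_genOne {f : E 4 → ℂ} (hf : f ∈ periodicEigenfunctions l) (y : E 4) :
    f (genTwo (genOne y)) = f (genOne (genTwo y)) := by
  refine periodicEigenfunctions_periodic hf ![0, 0, 0, 1] fun i => ?_
  rw [genTwo_apply, genOne_apply, genOne_apply, genTwo_apply]
  fin_cases i <;> simp
  ring

theorem apply_genThree_pow_four {f : E 4 → ℂ} (hf : f ∈ periodicEigenfunctions l) (y : E 4) :
    f (genThree (genThree (genThree (genThree y)))) = f y := by
  refine periodicEigenfunctions_periodic hf ![0, 0, 0, 1] fun i => ?_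
  rw [genThree_apply, genThree_apply, genThree_apply, genThree_apply]
  fin_cases i <;> simp
  ring

/-! ### Invariant forms in terms of their four coefficients. -/

section Coordinates

variable (Φ : (E 4 [⋀^Fin p]→L[ℝ] ℂ) ≃L[ℝ] (Fin 4 → ℂ))

/-- Φ is real-linear by its type, which suits the real derivatives; `hΦ` supplies the complex
homogeneity that the eigenvalue `l` requires. -/
theorem coord_mem_periodicEigenfunctions (hΦ : ∀ (c : ℂ) α, Φ (c • α) = c • Φ α)
    {Γ : Subgroup (E 4 ≃ᵃⁱ[ℝ] E 4)} (hΓ : latticeTranslations 4 ⊆ Γ)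
    {α : E 4 → E 4 [⋀^Fin p]→L[ℝ] ℂ} (hα : α ∈ invariantForms p Γ l) (i : Fin 4) :
    (fun y => Φ (α y) i) ∈ periodicEigenfunctions l := by
  let L : (E 4 [⋀^Fin p]→L[ℝ] ℂ) →L[ℝ] ℂ :=
    (ContinuousLinearMap.proj (R := ℝ) (φ := fun _ : Fin 4 => ℂ) i).comp
      (Φ : (E 4 [⋀^Fin p]→L[ℝ] ℂ) →L[ℝ] (Fin 4 → ℂ))
  refine ⟨L.contDiff.comp hα.1, ?_, fun y => ?_⟩
  · rintro _ ⟨v, rfl⟩ y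
    exact congrArg (fun β => Φ β i) (hα.2.1 _ (hΓ ⟨v, rfl⟩) y)
  · have h1 : Laplacian.laplacian (L ∘ α) y = L (Laplacian.laplacian α y) :=
      (hα.1.contDiffAt.of_le (WithTop.coe_le_coe.2 le_top)).laplacian_CLM_comp_left
    change -Laplacian.laplacian (L ∘ α) y = _
    rw [h1, ← map_neg, hα.2.2]
    exact congrFun (hΦ l (α y)) i

theorem neg_laplacian_symm_comp (hΦ : ∀ (c : ℂ) α, Φ (c • α) = c • Φ α) {F : E 4 → Fin 4 → ℂ}
    (hF : ∀ i, (fun y => F y i) ∈ periodicEigenfunctions l) (y : E 4) :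
    -Laplacian.laplacian (fun y => Φ.symm (F y)) y = l • Φ.symm (F y) := by
  have hs : ContDiff ℝ ∞ F := contDiff_pi.2 fun i => (hF i).1
  have h1 : Laplacian.laplacian (fun y => Φ.symm (F y)) y =
      Φ.symm (Laplacian.laplacian F y) :=
    (hs.contDiffAt.of_le (WithTop.coe_le_coe.2 le_top)).laplacian_CLM_comp_left
      (l := (Φ.symm : (Fin 4 → ℂ) →L[ℝ] (E 4 [⋀^Fin p]→L[ℝ] ℂ)))
  have h2 : -Laplacian.laplacian F y = l • F y := by
    funext i
    have h3 : Laplacian.laplacian (fun y => F y i) y = Laplacian.laplacian F y i :=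
      (hs.contDiffAt.of_le (WithTop.coe_le_coe.2 le_top)).laplacian_CLM_comp_left
        (l := ContinuousLinearMap.proj (R := ℝ) (φ := fun _ : Fin 4 => ℂ) i)
    have h4 := (hF i).2.2 y
    rw [h3] at h4
    exact h4
  rw [h1, ← map_neg, h2]
  apply Φ.injective
  rw [hΦ, Φ.apply_symm_apply, Φ.apply_symm_apply]

theorem symm_comp_lattice_invariant {F : E 4 → Fin 4 → ℂ}
    (hF : ∀ i, (fun y => F y i) ∈ periodicEigenfunctions l) (v : Fin 4 → ℤ) (y : E 4) :
    pullCLM (lin (translation (WithLp.toLp 2 fun i => (v i : ℝ))))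
      (Φ.symm (F (translation (WithLp.toLp 2 fun i => (v i : ℝ)) y))) = Φ.symm (F y) := by
  have h1 : F (translation (WithLp.toLp 2 fun i => (v i : ℝ)) y) = F y :=
    funext fun i => (hF i).2.1 _ ⟨v, rfl⟩ y
  rw [h1]
  rfl

theorem invariant_mul {α : E 4 → E 4 [⋀^Fin p]→L[ℝ] ℂ} (g g' : E 4 ≃ᵃⁱ[ℝ] E 4)
    (hg : ∀ y, pullCLM (lin g) (α (g y)) = α y) (hg' : ∀ y, pullCLM (lin g') (α (g' y)) = α y)
    (y : E 4) : pullCLM (lin (g * g')) (α ((g * g') y)) = α y := by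
  rw [pullCLM_mul, isometry_mul_apply, hg, hg']

theorem invariant_inv {α : E 4 → E 4 [⋀^Fin p]→L[ℝ] ℂ} (g : E 4 ≃ᵃⁱ[ℝ] E 4)
    (hg : ∀ y, pullCLM (lin g) (α (g y)) = α y) (y : E 4) :
    pullCLM (lin g⁻¹) (α (g⁻¹ y)) = α y := by
  rw [← hg (g⁻¹ y), isometry_apply_inv_apply, pullCLM_inv_pullCLM]

theorem symm_comp_mem_invariantForms_groupOne (hΦ : ∀ (c : ℂ) α, Φ (c • α) = c • Φ α)
    {F : E 4 → Fin 4 → ℂ} (hF : ∀ i, (fun y => F y i) ∈ periodicEigenfunctions l)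
    (h1 : ∀ y, Φ (pullCLM (lin genOne) (Φ.symm (F (genOne y)))) = F y)
    (h2 : ∀ y, Φ (pullCLM (lin genTwo) (Φ.symm (F (genTwo y)))) = F y) :
    (fun y => Φ.symm (F y)) ∈ invariantForms p groupOne l := by
  refine ⟨Φ.symm.contDiff.comp (contDiff_pi.2 fun i => (hF i).1), fun g hg => ?_,
    neg_laplacian_symm_comp Φ hΦ hF⟩
  exact groupOne_induction (P := fun g => ∀ y, pullCLM (lin g) (Φ.symm (F (g y))) = Φ.symm (F y))
    (fun y => by rw [← h1 y, Φ.symm_apply_apply]) (fun y => by rw [← h2 y, Φ.symm_apply_apply])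
    (symm_comp_lattice_invariant Φ hF) (invariant_mul (α := fun y => Φ.symm (F y)))
    (invariant_inv (α := fun y => Φ.symm (F y))) hg

theorem symm_comp_mem_invariantForms_groupTwo (hΦ : ∀ (c : ℂ) α, Φ (c • α) = c • Φ α)
    {F : E 4 → Fin 4 → ℂ} (hF : ∀ i, (fun y => F y i) ∈ periodicEigenfunctions l)
    (h1 : ∀ y, Φ (pullCLM (lin genThree) (Φ.symm (F (genThree y)))) = F y) :
    (fun y => Φ.symm (F y)) ∈ invariantForms p groupTwo l := by
  refine ⟨Φ.symm.contDiff.comp (contDiff_pi.2 fun i => (hF i).1), fun g hg => ?_,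
    neg_laplacian_symm_comp Φ hΦ hF⟩
  exact groupTwo_induction (P := fun g => ∀ y, pullCLM (lin g) (Φ.symm (F (g y))) = Φ.symm (F y))
    (fun y => by rw [← h1 y, Φ.symm_apply_apply])
    (symm_comp_lattice_invariant Φ hF) (invariant_mul (α := fun y => Φ.symm (F y)))
    (invariant_inv (α := fun y => Φ.symm (F y))) hg

/-- If the four coefficients of a form transform by the four characters of `ℤ₂ × ℤ₂`, the sum
of the coefficients identifies the invariant eigenforms with the periodic eigenfunctions. -/
theorem rank_invariantForms_groupOne (hΦ : ∀ (c : ℂ) α, Φ (c • α) = c • Φ α)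
    (h1 : ∀ α, Φ (pullCLM (lin genOne) α) = ![Φ α 0, Φ α 1, -Φ α 2, -Φ α 3])
    (h2 : ∀ α, Φ (pullCLM (lin genTwo) α) = ![Φ α 0, -Φ α 1, -Φ α 2, Φ α 3]) :
    Module.rank ℂ (invariantForms p groupOne l) = Module.rank ℂ (periodicEigenfunctions l) := by
  have hc := fun {α : E 4 → E 4 [⋀^Fin p]→L[ℝ] ℂ} (hα : α ∈ invariantForms p groupOne l) =>
    coord_mem_periodicEigenfunctions Φ hΦ lattice_subset_groupOne hα
  let T : invariantForms p groupOne l →ₗ[ℂ] periodicEigenfunctions l :=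
    { toFun := fun α => ⟨(fun y => Φ (α.1 y) 0) + (fun y => Φ (α.1 y) 1) +
          (fun y => Φ (α.1 y) 2) + (fun y => Φ (α.1 y) 3),
        add_mem (add_mem (add_mem (hc α.2 0) (hc α.2 1)) (hc α.2 2)) (hc α.2 3)⟩
      map_add' := fun α β => Subtype.ext (funext fun y => by
        simp only [Submodule.coe_add, Pi.add_apply, map_add]
        ring)
      map_smul' := fun c α => Subtype.ext (funext fun y => by
        simp only [Submodule.coe_smul, Pi.add_apply, Pi.smul_apply, hΦ, RingHom.id_apply,
          smul_eq_mul]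
        ring) }
  refine (LinearEquiv.ofBijective T ⟨?_, ?_⟩).rank_eq
  · rw [injective_iff_map_eq_zero]
    intro α hα
    have hT : ∀ y, Φ (α.1 y) 0 + Φ (α.1 y) 1 + Φ (α.1 y) 2 + Φ (α.1 y) 3 = 0 := fun y =>
      congrFun (congrArg Subtype.val hα) y
    have ha : ∀ y, ![Φ (α.1 (genOne y)) 0, Φ (α.1 (genOne y)) 1, -Φ (α.1 (genOne y)) 2,
        -Φ (α.1 (genOne y)) 3] = Φ (α.1 y) := fun y => by
      rw [← h1, α.2.2.1 _ genOne_mem]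
    have hb : ∀ y, ![Φ (α.1 (genTwo y)) 0, -Φ (α.1 (genTwo y)) 1, -Φ (α.1 (genTwo y)) 2,
        Φ (α.1 (genTwo y)) 3] = Φ (α.1 y) := fun y => by
      rw [← h2, α.2.2.1 _ genTwo_mem]
    -- Evaluating the vanishing sum at translated points changes the signs of the coefficients by
    -- the characters. The four relations form the character table of ℤ₂ × ℤ₂, which is inverted
    -- below.
    have hA : ∀ y, Φ (α.1 y) 0 + Φ (α.1 y) 1 - Φ (α.1 y) 2 - Φ (α.1 y) 3 = 0 := fun y => by
      rw [← hT (genOne y), ← ha y]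
      simp
    have hB : ∀ y, Φ (α.1 y) 0 - Φ (α.1 y) 1 - Φ (α.1 y) 2 + Φ (α.1 y) 3 = 0 := fun y => by
      rw [← hT (genTwo y), ← hb y]
      simp
    have hAB : ∀ y, Φ (α.1 y) 0 - Φ (α.1 y) 1 + Φ (α.1 y) 2 - Φ (α.1 y) 3 = 0 := fun y => by
      rw [← hA (genTwo y), ← hb y]
      simp
      ring
    refine Subtype.ext (funext fun y => Φ.injective ?_)
    change Φ (α.1 y) = Φ 0
    rw [map_zero]
    funext i
    fin_cases i
    · change Φ (α.1 y) 0 = 0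
      linear_combination (hT y + hA y + hB y + hAB y) / 4
    · change Φ (α.1 y) 1 = 0
      linear_combination (hT y + hA y - hB y - hAB y) / 4
    · change Φ (α.1 y) 2 = 0
      linear_combination (hT y - hA y - hB y + hAB y) / 4
    · change Φ (α.1 y) 3 = 0
      linear_combination (hT y - hA y + hB y - hAB y) / 4
  · rintro ⟨f, hf⟩
    have hfa := comp_genOne_mem hf
    have hfb := comp_genTwo_mem hf
    have hfab := comp_genTwo_mem hfa
    -- The entries are the projections of f to its four isotypic components, matched with the
    -- characters in `h1` and `h2`; they add up to f.
    let F : E 4 → Fin 4 → ℂ := fun y =>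
      ![4⁻¹ * (f y + f (genOne y) + f (genTwo y) + f (genOne (genTwo y))),
        4⁻¹ * (f y + f (genOne y) - f (genTwo y) - f (genOne (genTwo y))),
        4⁻¹ * (f y - f (genOne y) - f (genTwo y) + f (genOne (genTwo y))),
        4⁻¹ * (f y - f (genOne y) + f (genTwo y) - f (genOne (genTwo y)))]
    have hF : ∀ i, (fun y => F y i) ∈ periodicEigenfunctions l := by
      intro i
      fin_cases i
      · exact Submodule.smul_mem _ _ (add_mem (add_mem (add_mem hf hfa) hfb) hfab)
      · exact Submodule.smul_mem _ _ (sub_mem (sub_mem (add_mem hf hfa) hfb) hfab)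
      · exact Submodule.smul_mem _ _ (add_mem (sub_mem (sub_mem hf hfa) hfb) hfab)
      · exact Submodule.smul_mem _ _ (sub_mem (add_mem (sub_mem hf hfa) hfb) hfab)
    have hmem : (fun y => Φ.symm (F y)) ∈ invariantForms p groupOne l := by
      refine symm_comp_mem_invariantForms_groupOne Φ hΦ hF (fun y => ?_) fun y => ?_
      · rw [h1, Φ.apply_symm_apply]
        have e1 := apply_genOne_genOne hf y
        have e2 := apply_genTwo_genOne hf y
        have e3 : f (genOne (genTwo (genOne y))) = f (genTwo y) := by
          rw [apply_genTwo_genOne hfa, apply_genOne_genOne hf]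
        funext i
        fin_cases i <;> simp [F, e1, e2, e3] <;> ring
      · rw [h2, Φ.apply_symm_apply]
        have e1 := apply_genTwo_genTwo hf y
        have e2 := apply_genTwo_genTwo hfa y
        funext i
        fin_cases i <;> simp [F, e1, e2] <;> ring
    refine ⟨⟨_, hmem⟩, Subtype.ext (funext fun y => ?_)⟩
    change Φ (Φ.symm (F y)) 0 + Φ (Φ.symm (F y)) 1 + Φ (Φ.symm (F y)) 2 +
      Φ (Φ.symm (F y)) 3 = f y
    rw [Φ.apply_symm_apply]
    simp [F]
    ring

/-- If the four coefficients of a form transform by the regular representation of `ℤ₄`, then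
the invariant eigenforms are identified with the periodic eigenfunctions. -/
theorem rank_invariantForms_groupTwo (hΦ : ∀ (c : ℂ) α, Φ (c • α) = c • Φ α)
    (h1 : ∀ α, Φ (pullCLM (lin genThree) α) = ![-Φ α 1, Φ α 0, -Φ α 2, Φ α 3]) :
    Module.rank ℂ (invariantForms p groupTwo l) = Module.rank ℂ (periodicEigenfunctions l) := by
  have hc := fun {α : E 4 → E 4 [⋀^Fin p]→L[ℝ] ℂ} (hα : α ∈ invariantForms p groupTwo l) =>
    coord_mem_periodicEigenfunctions Φ hΦ lattice_subset_groupTwo hα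
  -- Coefficient 1 is left out because the generator already mixes coefficients 0 and 1: the orbit
  -- of this functional spans all four coordinates.
  let T : invariantForms p groupTwo l →ₗ[ℂ] periodicEigenfunctions l :=
    { toFun := fun α => ⟨(fun y => Φ (α.1 y) 0) + (fun y => Φ (α.1 y) 2) +
          (fun y => Φ (α.1 y) 3), add_mem (add_mem (hc α.2 0) (hc α.2 2)) (hc α.2 3)⟩
      map_add' := fun α β => Subtype.ext (funext fun y => by
        simp only [Submodule.coe_add, Pi.add_apply, map_add]
        ring)
      map_smul' := fun c α => Subtype.ext (funext fun y => by
        simp only [Submodule.coe_smul, Pi.add_apply, Pi.smul_apply, hΦ, RingHom.id_apply,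
          smul_eq_mul]
        ring) }
  refine (LinearEquiv.ofBijective T ⟨?_, ?_⟩).rank_eq
  · rw [injective_iff_map_eq_zero]
    intro α hα
    have hT : ∀ y, Φ (α.1 y) 0 + Φ (α.1 y) 2 + Φ (α.1 y) 3 = 0 := fun y =>
      congrFun (congrArg Subtype.val hα) y
    have ha : ∀ y, ![-Φ (α.1 (genThree y)) 1, Φ (α.1 (genThree y)) 0, -Φ (α.1 (genThree y)) 2,
        Φ (α.1 (genThree y)) 3] = Φ (α.1 y) := fun y => by
      rw [← h1, α.2.2.1 _ genThree_mem]
    -- Moving the point by the generator three times in succession gives the orbit of the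
    -- functional, four independent relations in all.
    have hA : ∀ y, Φ (α.1 y) 1 - Φ (α.1 y) 2 + Φ (α.1 y) 3 = 0 := fun y => by
      rw [← hT (genThree y), ← ha y]
      simp
    have hB : ∀ y, -Φ (α.1 y) 0 + Φ (α.1 y) 2 + Φ (α.1 y) 3 = 0 := fun y => by
      rw [← hA (genThree y), ← ha y]
      simp
      ring
    have hC : ∀ y, -Φ (α.1 y) 1 - Φ (α.1 y) 2 + Φ (α.1 y) 3 = 0 := fun y => by
      rw [← hB (genThree y), ← ha y]
      simp
    refine Subtype.ext (funext fun y => Φ.injective ?_)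
    change Φ (α.1 y) = Φ 0
    rw [map_zero]
    funext i
    fin_cases i
    · change Φ (α.1 y) 0 = 0
      linear_combination (hT y - hB y) / 2
    · change Φ (α.1 y) 1 = 0
      linear_combination (hA y - hC y) / 2
    · change Φ (α.1 y) 2 = 0
      linear_combination (hT y - hA y + hB y - hC y) / 4
    · change Φ (α.1 y) 3 = 0
      linear_combination (hT y + hA y + hB y + hC y) / 4
  · rintro ⟨f, hf⟩
    have hf1 := comp_genThree_mem hf
    have hf2 := comp_genThree_mem hf1
    have hf3 := comp_genThree_mem hf2
    -- Entry 0 is the part of f negated by the square of the generator, and entry 1 is its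
    -- translate; entries 2 and 3 are the parts on which the generator acts by -1 and 1. Entries 0,
    -- 2 and 3 add up to f.
    let F : E 4 → Fin 4 → ℂ := fun y =>
      ![2⁻¹ * (f y - f (genThree (genThree y))),
        2⁻¹ * (f (genThree y) - f (genThree (genThree (genThree y)))),
        4⁻¹ * (f y - f (genThree y) + f (genThree (genThree y)) -
          f (genThree (genThree (genThree y)))),
        4⁻¹ * (f y + f (genThree y) + f (genThree (genThree y)) +
          f (genThree (genThree (genThree y))))]
    have hF : ∀ i, (fun y => F y i) ∈ periodicEigenfunctions l := by
      intro i
      fin_cases i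
      · exact Submodule.smul_mem _ _ (sub_mem hf hf2)
      · exact Submodule.smul_mem _ _ (sub_mem hf1 hf3)
      · exact Submodule.smul_mem _ _ (sub_mem (add_mem (sub_mem hf hf1) hf2) hf3)
      · exact Submodule.smul_mem _ _ (add_mem (add_mem (add_mem hf hf1) hf2) hf3)
    have hmem : (fun y => Φ.symm (F y)) ∈ invariantForms p groupTwo l := by
      refine symm_comp_mem_invariantForms_groupTwo Φ hΦ hF fun y => ?_
      rw [h1, Φ.apply_symm_apply]
      have e1 := apply_genThree_pow_four hf y
      funext i
      fin_cases i <;> simp [F, e1] <;> ring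
    refine ⟨⟨_, hmem⟩, Subtype.ext (funext fun y => ?_)⟩
    change Φ (Φ.symm (F y)) 0 + Φ (Φ.symm (F y)) 2 + Φ (Φ.symm (F y)) 3 = f y
    rw [Φ.apply_symm_apply]
    simp [F]
    ring

end Coordinates

/-! ### Coordinates on constant forms of degree one and three -/

section Forms

variable {p : ℕ}

/-- The constant form `dx_{s 0} ∧ ⋯ ∧ dx_{s (p - 1)}`. -/
def wedgeForm (s : Fin p → Fin 4) : E 4 [⋀^Fin p]→L[ℝ] ℂ where
  toMultilinearMap := (Complex.ofRealCLM.toLinearMap.compAlternatingMap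
    ((Matrix.detRowAlternating (n := Fin p) (R := ℝ)).compLinearMap
      { toFun := fun (x : E 4) c => x (s c)
        map_add' := fun _ _ => rfl
        map_smul' := fun _ _ => rfl })).toMultilinearMap
  cont := by
    change Continuous fun v : Fin p → E 4 =>
      ((Matrix.det (Matrix.of fun a c => v a (s c)) : ℝ) : ℂ)
    refine Complex.continuous_ofReal.comp (Continuous.matrix_det ?_)
    fun_prop
  map_eq_zero_of_eq' := AlternatingMap.map_eq_zero_of_eq' _

theorem wedgeForm_apply (s : Fin p → Fin 4) (v : Fin p → E 4) :
    wedgeForm s v = ((Matrix.det (Matrix.of fun a c => v a (s c)) : ℝ) : ℂ) := rfl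

/-- `hcover` says that up to reordering the tuples `s i` exhaust the basis p-vectors, which gives
injectivity. `hs` says that the forms `wedgeForm (s i)` are dual to them, which gives surjectivity.
-/
theorem exists_formCoordinates (s : Fin 4 → Fin p → Fin 4)
    (hs : ∀ i j, Matrix.det (Matrix.of fun a c =>
      (EuclideanSpace.single (s j a) (1 : ℝ) : E 4) (s i c)) = if i = j then 1 else 0)
    (hcover : ∀ v : Fin p → Fin 4, Function.Injective v →
      ∃ (i : Fin 4) (σ : Equiv.Perm (Fin p)), v = s i ∘ σ) :
    ∃ Φ : (E 4 [⋀^Fin p]→L[ℝ] ℂ) ≃L[ℝ] (Fin 4 → ℂ),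
      ∀ α i, Φ α i = α fun a => EuclideanSpace.single (s i a) 1 := by
  let f : (E 4 [⋀^Fin p]→L[ℝ] ℂ) →ₗ[ℝ] (Fin 4 → ℂ) :=
    { toFun := fun α i => α fun a => EuclideanSpace.single (s i a) 1
      map_add' := fun _ _ => rfl
      map_smul' := fun _ _ => rfl }
  have hinj : Function.Injective f := by
    rw [injective_iff_map_eq_zero]
    intro α hα
    apply ContinuousAlternatingMap.toAlternatingMap_injective
    refine Module.Basis.ext_alternating (EuclideanSpace.basisFun (Fin 4) ℝ).toBasis fun v hv => ?_
    obtain ⟨i, σ, rfl⟩ := hcover v hv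
    have h1 := α.toAlternatingMap.map_perm (fun a => EuclideanSpace.single (s i a) (1 : ℝ)) σ
    have h2 : α (fun a => EuclideanSpace.single (s i a) (1 : ℝ)) = 0 := congrFun hα i
    have h3 : α.toAlternatingMap (fun a => EuclideanSpace.single (s i a) (1 : ℝ)) = 0 := h2
    rw [h3, smul_zero] at h1
    simpa [Function.comp_def] using h1
  have hsurj : Function.Surjective f := by
    intro c
    refine ⟨∑ i, c i • wedgeForm (s i), funext fun j => ?_⟩
    change (∑ i, c i • wedgeForm (s i)) (fun a => EuclideanSpace.single (s j a) (1 : ℝ)) = c j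
    rw [ContinuousAlternatingMap.sum_apply]
    simp only [ContinuousAlternatingMap.smul_apply, wedgeForm_apply, hs,
      apply_ite Complex.ofReal]
    simp
  let e := LinearEquiv.ofBijective f ⟨hinj, hsurj⟩
  have : FiniteDimensional ℝ (E 4 [⋀^Fin p]→L[ℝ] ℂ) := Module.Finite.of_injective f hinj
  exact ⟨e.toContinuousLinearEquiv, fun _ _ => rfl⟩

theorem lin_genOne_single (j : Fin 4) : lin genOne (EuclideanSpace.single j (1 : ℝ)) =
    (![1, 1, -1, -1] j : ℝ) • EuclideanSpace.single j (1 : ℝ) := by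
  rw [lin_apply, linearPart_genOne_apply]
  ext i
  fin_cases j <;> fin_cases i <;> simp

theorem lin_genTwo_single (j : Fin 4) : lin genTwo (EuclideanSpace.single j (1 : ℝ)) =
    (![1, -1, -1, 1] j : ℝ) • EuclideanSpace.single j (1 : ℝ) := by
  rw [lin_apply, linearPart_genTwo_apply]
  ext i
  fin_cases j <;> fin_cases i <;> simp

theorem lin_genThree_single (j : Fin 4) : lin genThree (EuclideanSpace.single j (1 : ℝ)) =
    (![-1, 1, -1, 1] j : ℝ) • EuclideanSpace.single ((![1, 0, 2, 3] : Fin 4 → Fin 4) j) (1 : ℝ) := by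
  rw [lin_apply, linearPart_genThree_apply]
  ext i
  fin_cases j <;> fin_cases i <;> simp

theorem pullCLM_apply_single {g : E 4 ≃ᵃⁱ[ℝ] E 4} {c : Fin 4 → ℝ} {τ : Fin 4 → Fin 4}
    (hg : ∀ j, lin g (EuclideanSpace.single j (1 : ℝ)) =
      c j • EuclideanSpace.single (τ j) (1 : ℝ)) (α : E 4 [⋀^Fin p]→L[ℝ] ℂ) (s : Fin p → Fin 4) :
    pullCLM (lin g) α (fun a => EuclideanSpace.single (s a) 1) =
      (∏ a, c (s a)) • α fun a => EuclideanSpace.single (τ (s a)) 1 := by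
  have h1 : pullCLM (lin g) α (fun a => EuclideanSpace.single (s a) 1) =
      α fun a => lin g (EuclideanSpace.single (s a) 1) := rfl
  rw [h1]
  simp only [hg]
  exact α.toMultilinearMap.map_smul_univ (fun a => c (s a))
    (fun a => EuclideanSpace.single (τ (s a)) 1)

theorem formCoordinates_smul {s : Fin 4 → Fin p → Fin 4}
    {Φ : (E 4 [⋀^Fin p]→L[ℝ] ℂ) ≃L[ℝ] (Fin 4 → ℂ)}
    (hΦ : ∀ α i, Φ α i = α fun a => EuclideanSpace.single (s i a) 1) (c : ℂ)
    (α : E 4 [⋀^Fin p]→L[ℝ] ℂ) : Φ (c • α) = c • Φ α := by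
  funext i
  rw [hΦ, Pi.smul_apply, hΦ]
  rfl

theorem exists_formCoordinates_one : ∃ Φ : (E 4 [⋀^Fin 1]→L[ℝ] ℂ) ≃L[ℝ] (Fin 4 → ℂ),
    ∀ α i, Φ α i = α fun _ => EuclideanSpace.single i 1 := by
  refine exists_formCoordinates (fun i _ => i) (fun i j => ?_) fun v _ => ⟨v 0, 1, ?_⟩
  · simp
  · funext a
    rw [Subsingleton.elim a 0]
    rfl

/-- A basis 3-form is indexed by the direction i that it omits; `i.succAbove` lists the other three
in increasing order. -/
theorem exists_formCoordinates_three : ∃ Φ : (E 4 [⋀^Fin 3]→L[ℝ] ℂ) ≃L[ℝ] (Fin 4 → ℂ),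
    ∀ α i, Φ α i = α fun a => EuclideanSpace.single (i.succAbove a) 1 := by
  refine exists_formCoordinates (fun i => i.succAbove) (fun i j => ?_) fun v hv => ?_
  · rw [Matrix.det_fin_three]
    fin_cases i <;> fin_cases j <;> simp [Fin.succAbove, Fin.lt_def]
  · obtain ⟨i, hi⟩ : ∃ i, ∀ a, v a ≠ i := by
      by_contra! h
      have := Fintype.card_le_of_surjective v h
      simp at this
    choose τ hτ using fun a => Fin.exists_succAbove_eq (hi a)
    have hinj : Function.Injective τ := fun a b hab => hv (by rw [← hτ a, ← hτ b, hab])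
    exact ⟨i, Equiv.ofBijective τ (Finite.injective_iff_bijective.1 hinj),
      funext fun a => (hτ a).symm⟩

/-! ### Comparison of the two groups in each odd degree. -/

theorem rank_invariantForms_one (l : ℂ) :
    Module.rank ℂ (invariantForms 1 groupOne l) = Module.rank ℂ (invariantForms 1 groupTwo l) := by
  obtain ⟨Φ, hΦ⟩ := exists_formCoordinates_one
  have hsm := formCoordinates_smul hΦ
  rw [rank_invariantForms_groupOne Φ hsm, rank_invariantForms_groupTwo Φ hsm]
  · intro α
    funext i
    rw [hΦ, pullCLM_apply_single lin_genThree_single]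
    fin_cases i <;> simp [hΦ]
  · intro α
    funext i
    rw [hΦ, pullCLM_apply_single (τ := id) lin_genOne_single]
    fin_cases i <;> simp [hΦ]
  · intro α
    funext i
    rw [hΦ, pullCLM_apply_single (τ := id) lin_genTwo_single]
    fin_cases i <;> simp [hΦ]

theorem rank_invariantForms_three (l : ℂ) :
    Module.rank ℂ (invariantForms 3 groupOne l) = Module.rank ℂ (invariantForms 3 groupTwo l) := by
  obtain ⟨Φ, hΦ⟩ := exists_formCoordinates_three
  have hsm := formCoordinates_smul hΦ
  -- On 3-forms the action is that on the omitted directions twisted by the determinant. Since det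
  -- B₁ = det B₂ = 1, Φ serves Γ unchanged; det B' = -1 exchanges the eigenvalues ±1, hence the swap
  -- of coordinates 2 and 3 for Γ'.
  let Ψ := Φ.trans (LinearEquiv.funCongrLeft ℝ ℂ
    (Equiv.swap (2 : Fin 4) 3)).toContinuousLinearEquiv
  have hΨ : ∀ α i, Ψ α i = α fun a =>
      EuclideanSpace.single ((Equiv.swap (2 : Fin 4) 3 i).succAbove a) 1 := fun α i => hΦ α _
  have hsm' := formCoordinates_smul hΨ
  rw [rank_invariantForms_groupOne Φ hsm, rank_invariantForms_groupTwo Ψ hsm']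
  · intro α
    funext i
    rw [hΨ, pullCLM_apply_single lin_genThree_single, Fin.prod_univ_three]
    -- B' permutes the indices, so the resulting triple may be out of order; σ sorts it at the cost
    -- of its sign. Only triples containing both 0 and 1 need a transposition.
    have h0 : ∀ (m : Fin 4 → Fin 4) (i j : Fin 4) (σ : Equiv.Perm (Fin 3)),
        (∀ a, m ((Equiv.swap (2 : Fin 4) 3 i).succAbove a) =
          (Equiv.swap (2 : Fin 4) 3 j).succAbove (σ a)) →
        α (fun a => EuclideanSpace.single (m ((Equiv.swap (2 : Fin 4) 3 i).succAbove a)) 1) =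
          Equiv.Perm.sign σ • Ψ α j := by
      intro m i j σ hm
      rw [hΨ]
      simp only [hm]
      exact α.toAlternatingMap.map_perm (fun a => EuclideanSpace.single
        ((Equiv.swap (2 : Fin 4) 3 j).succAbove a) (1 : ℝ)) σ
    fin_cases i
    · rw [h0 _ _ 1 1 (by decide)]
      simp [Fin.succAbove, Equiv.swap_apply_def]
    · rw [h0 _ _ 0 1 (by decide)]
      simp [Fin.succAbove, Equiv.swap_apply_def]
    · rw [h0 _ _ 2 (Equiv.swap 0 1) (by decide)]
      simp [Fin.succAbove, Fin.lt_def]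
    · rw [h0 _ _ 3 (Equiv.swap 0 1) (by decide)]
      simp [Fin.succAbove, Fin.lt_def]
  · intro α
    funext i
    rw [hΦ, pullCLM_apply_single (τ := id) lin_genOne_single, Fin.prod_univ_three]
    fin_cases i <;> simp [hΦ, Fin.succAbove, Fin.lt_def]
  · intro α
    funext i
    rw [hΦ, pullCLM_apply_single (τ := id) lin_genTwo_single, Fin.prod_univ_three]
    fin_cases i <;> simp [hΦ, Fin.succAbove, Fin.lt_def]

theorem subsingleton_forms (hp : 4 < p) : Subsingleton (E 4 [⋀^Fin p]→L[ℝ] ℂ) := by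
  refine ⟨fun α β => ContinuousAlternatingMap.ext fun v => ?_⟩
  have hv : ¬LinearIndependent ℝ v := fun h => by
    have := h.fintype_card_le_finrank
    simp at this
    omega
  exact (α.toAlternatingMap.map_linearDependent v hv).trans
    (β.toAlternatingMap.map_linearDependent v hv).symm

theorem pIsospectral_of_odd (hp : Odd p) :
    PIsospectral p 4 (FlatQuotient groupOne isBieberbach_groupOne)
      (FlatQuotient groupTwo isBieberbach_groupTwo) := by
  intro l
  rw [rank_eigenforms_eq, rank_eigenforms_eq]
  rcases lt_or_ge 4 p with h | h
  · have := subsingleton_forms h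
    rw [rank_subsingleton', rank_subsingleton']
  · interval_cases p
    · exact absurd hp (by decide)
    · exact rank_invariantForms_one l
    · exact absurd hp (by decide)
    · exact rank_invariantForms_three l
    · exact absurd hp (by decide)

/-- The holonomy group consists of automorphisms of a tangent space, which is `E n` only after
unfolding; the ambient group is a variable here so that it can be given as `E 4 ≃ₗ[ℝ] E 4`. -/
theorem nonempty_mulEquiv_of_eq {G H : Type} [Group G] [Mul H] {S T : Subgroup G} (h : S = T)
    (e : Nonempty (T ≃* H)) : Nonempty (S ≃* H) := h ▸ e

end Forms

end FlatGeom

end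

open FlatGeom
theorem mainTheorem7 :
    ∃ (h₁ : IsBieberbach groupOne) (h₂ : IsBieberbach groupTwo),
      -- the two quotients are closed flat 4-manifolds
      IsClosedFlatManifold 4 (FlatQuotient groupOne h₁) ∧
      IsClosedFlatManifold 4 (FlatQuotient groupTwo h₂) ∧
      -- point groups and holonomy groups
      Nonempty (pointGroup groupOne ≃* Multiplicative (ZMod 2 × ZMod 2)) ∧
      Nonempty (pointGroup groupTwo ≃* Multiplicative (ZMod 4)) ∧
      (∀ x : FlatQuotient groupOne h₁,
        Nonempty (holonomyGroup 4 x ≃* Multiplicative (ZMod 2 × ZMod 2))) ∧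
      (∀ x : FlatQuotient groupTwo h₂,
        Nonempty (holonomyGroup 4 x ≃* Multiplicative (ZMod 4))) ∧
      ∀ p : ℕ, Odd p →
        -- the odd traces of the nontrivial elements vanish
        (∀ B ∈ pointGroup groupOne, B ≠ 1 → extTrace p B.toLinearMap = 0) ∧
        (∀ B ∈ pointGroup groupTwo, B ≠ 1 → extTrace p B.toLinearMap = 0) ∧
        (∀ x : FlatQuotient groupOne h₁, ∀ A ∈ holonomyGroup 4 x, A ≠ 1 →
          extTrace p A.toLinearMap = 0) ∧
        (∀ x : FlatQuotient groupTwo h₂, ∀ A ∈ holonomyGroup 4 x, A ≠ 1 →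
          extTrace p A.toLinearMap = 0) ∧
        -- the manifolds are isospectral on `p`-forms
        PIsospectral p 4 (FlatQuotient groupOne h₁) (FlatQuotient groupTwo h₂) := by
  refine ⟨isBieberbach_groupOne, isBieberbach_groupTwo, isClosedFlatManifold_flatQuotient _,
    isClosedFlatManifold_flatQuotient _, nonempty_pointGroup_groupOne_mulEquiv,
    nonempty_pointGroup_groupTwo_mulEquiv, fun x => ?_, fun x => ?_, fun p hp =>
    ⟨fun B => extTrace_pointGroup_groupOne hp, fun B => extTrace_pointGroup_groupTwo hp,
      fun x A hA => ?_, fun x A hA => ?_, pIsospectral_of_odd hp⟩⟩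
  · exact nonempty_mulEquiv_of_eq (G := E 4 ≃ₗ[ℝ] E 4)
      (holonomyGroup_eq isBieberbach_groupOne x) nonempty_pointGroup_groupOne_mulEquiv
  · exact nonempty_mulEquiv_of_eq (G := E 4 ≃ₗ[ℝ] E 4)
      (holonomyGroup_eq isBieberbach_groupTwo x) nonempty_pointGroup_groupTwo_mulEquiv
  · exact extTrace_pointGroup_groupOne hp (B := A)
      ((holonomyGroup_eq isBieberbach_groupOne x).le hA)
  · exact extTrace_pointGroup_groupTwo hp (B := A)
      ((holonomyGroup_eq isBieberbach_groupTwo x).le hA)
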